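/- Let $n\ge 1$, let $S^{n-1}$ be the unit sphere of $\mathbb{R}^n$, and write $du$ for $(n-1)$-dimensional Hausdorff (surface) measure on $S^{n-1}$. Let $\mathcal{K}^n_{(o)}$ be the class of compact convex sets in $\mathbb{R}^n$ that contain the origin $o$ in their interiors. For $K\in\mathcal{K}^n_{(o)}$ let $h_K(u)=\max\{\langle u,x\rangle: x\in K\}$ be its support function, $\rho_K(u)=\max\{\lambda\ge 0:\lambda u\in K\}$ its radial function, and $N(K,x)=\{y:\langle y,z-x\rangle\le 0 \text{ for all } z\in K\}$ its normal cone at $x\in K$. For $E\subset S^{n-1}$ let $$\boldsymbol{\alpha}^*_K(E)=\{u\in S^{n-1}: N(K,\rho_K(u)u)\cap E\neq\emptyset\},$$ and for almost every $u\in S^{n-1}$ let $\alpha_K(u)$ be the unique unit vector in $N(K,\rho_K(u)u)$. Let $G:(0,\infty)\times S^{n-1}\to(0,\infty)$ be continuous and such that $G_t=\partial G(t,u)/\partial t$ exists and is continuous and negative on $(0,\infty)\times S^{n-1}$. Let $0<\varepsilon_0<1$ and suppose that for every $v\in S^{n-1}$, $$\lim_{t\to0+}\int_{\{u\in S^{n-1}:\,\langle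 u,v\rangle\ge\varepsilon_0\}}G(t,u)\,du=\infty .$$ Let $\psi:(0,\infty)\to(0,\infty)$ be continuous, with $$\int_1^\infty\frac{\psi(s)}{s}\,ds=\infty\qquad\text{and}\qquad \varphi(t)=\int_0^t\frac{\psi(s)}{s}\,ds<\infty\quad\text{for all } t>0 .$$ For $K\in\mathcal{K}^n_{(o)}$ the general dual Orlicz curvature measure of $K$ is the finite signed Borel measure on $S^{n-1}$ given by $$\widetilde{C}_{G,\psi}(K,E)=\frac1n\int_{\boldsymbol{\alpha}^*_K(E)}\frac{\rho_K(u)\,G_t(\rho_K(u),u)}{\psi(h_K(\alpha_K(u)))}\,du\qquad(E\subset S^{n-1}\text{ Borel}).$$ Let $\mu$ be a finite Borel measure on $S^{n-1}$. Then the following are equivalent: (i) $\mu$ is not concentrated on any closed hemisphere, that is, $\int_{S^{n-1}}\max\{\langle u,v\rangle,0\}\,d\mu(u)>0$ for every $v\in S^{n-1}$. (ii) There exist $K\in\mathcal{K}^n_{(o)}$ and $\tau<0$ such that $\mu=\tau\,\widetilde{C}_{G,\psi}(K,\cdot)$, where $\tau=\mu(S^{n-1})/\widetilde{C}_{G,\psi}(K,S^{n-1})$.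 -/

import Mathlib

open Set Filter Topology MeasureTheory

noncomputable section

namespace DualOrlicz

/-- Euclidean space `ℝⁿ`. -/
abbrev Space (n : ℕ) : Type := EuclideanSpace ℝ (Fin n)

/-- The unit sphere `S^{n-1}` of `ℝⁿ`. -/
abbrev Sphere (n : ℕ) : Type := Metric.sphere (0 : Space n) 1

/-- The surface measure `du` on `S^{n-1}`: the measure of `A` is `n` times the volume of the cone
`{t u : 0 < t < 1, u ∈ A}`. This is `(n-1)`-dimensional Hausdorff measure, normalized so that the
whole sphere has measure `n κ_n`, with `κ_n` the volume of the unit ball. -/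
def surfaceMeasure (n : ℕ) : Measure (Sphere n) := (volume : Measure (Space n)).toSphere

variable {n : ℕ}

/-- The support function `h_K(u) = max {⟨u, x⟩ : x ∈ K}`. -/
def supportFunction (K : Set (Space n)) (u : Space n) : ℝ := sSup ((fun x => inner ℝ u x) '' K)

/-- The radial function `ρ_K(x) = max {c ≥ 0 : c x ∈ K}`. -/
def radialFunction (K : Set (Space n)) (x : Space n) : ℝ := sSup {c : ℝ | 0 ≤ c ∧ c • x ∈ K}

/-- The radial map `r_K(u) = ρ_K(u) u` on the sphere. -/
def radialMap (K : Set (Space n)) (u : Sphere n) : Space n :=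
  radialFunction K (u : Space n) • (u : Space n)

/-- The normal cone `N(K, z) = {y : ⟨y, x - z⟩ ≤ 0 for all x ∈ K}`. -/
def normalCone (K : Set (Space n)) (z : Space n) : Set (Space n) :=
  {y | ∀ x ∈ K, inner ℝ y (x - z) ≤ 0}

/-- The spherical image of `E`: all outer unit normal vectors of `K` at points of `E`. -/
def sphericalImage (K E : Set (Space n)) : Set (Sphere n) :=
  {v | ∃ x ∈ E, (v : Space n) ∈ normalCone K x}

/-- The radial spherical image of `A`, a subset of the sphere. -/
def radialSphericalImage (K : Set (Space n)) (A : Set (Sphere n)) : Set (Sphere n) :=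
  sphericalImage K (radialMap K '' A)

/-- The reverse spherical image of `A`: the boundary points of `K` at which some vector in `A` is
an outer normal vector. -/
def reverseSphericalImage (K : Set (Space n)) (A : Set (Sphere n)) : Set (Space n) :=
  {x | x ∈ frontier K ∧ ∃ v ∈ A, (v : Space n) ∈ normalCone K x}

/-- The reverse radial spherical image of `A`. -/
def reverseRadialSphericalImage (K : Set (Space n)) (A : Set (Sphere n)) : Set (Sphere n) :=
  radialMap K ⁻¹' reverseSphericalImage K A

open Classical in
/-- The radial Gauss map `α_K`: if the radial spherical image of `{u}` is a single vector, then
`α_K(u)` is this vector. This is so for almost every `u` when `0` is an interior point of the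
convex body `K`; at the other `u` the value is arbitrary. -/
def radialGaussMap (K : Set (Space n)) (u : Sphere n) : Sphere n :=
  if h : ∃ v, radialSphericalImage K {u} = {v} then h.choose else u

/-- The partial derivative `G_t(t, u) = ∂G(t, u)/∂t`. -/
def partialT (G : ℝ → Sphere n → ℝ) (t : ℝ) (u : Sphere n) : ℝ := deriv (fun s => G s u) t

/-- The general dual Orlicz curvature measure `C̃_{G,ψ}(K, ·)` of a convex body `K` with `0` in its
interior, as a real-valued function of Borel sets `E` of the sphere. -/
def dualOrliczCurvature (G : ℝ → Sphere n → ℝ) (ψ : ℝ → ℝ) (K : Set (Space n))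
    (E : Set (Sphere n)) : ℝ :=
  (1 / (n : ℝ)) * ∫ u in reverseRadialSphericalImage K E,
    radialFunction K (u : Space n) * partialT G (radialFunction K (u : Space n)) u /
      ψ (supportFunction K (radialGaussMap K u : Space n)) ∂(surfaceMeasure n)

/-- The cap `Σ_ε(v) = {u : ⟨u, v⟩ ≥ ε}` of the sphere. -/
def cap (ε : ℝ) (v : Sphere n) : Set (Sphere n) :=
  {u | ε ≤ inner ℝ (u : Space n) (v : Space n)}

/-- The measure `μ` is not concentrated on any closed hemisphere. -/
def NotConcentratedOnHemisphere (μ : Measure (Sphere n)) : Prop :=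
  ∀ v : Sphere n, 0 < ∫ u : Sphere n, max (inner ℝ (u : Space n) (v : Space n)) 0 ∂μ

/-- The function `φ(t) = ∫_0^t ψ(s)/s ds`, with values in `[0, ∞]`, for a nonnegative `ψ`. -/
def orliczPhi (ψ : ℝ → ℝ) (t : ℝ) : ENNReal := ∫⁻ s in Ioc 0 t, ENNReal.ofReal (ψ s / s)

end DualOrlicz

end

/-!
For a positive continuous function `h` on the sphere let `W(h)` be its Wulff shape, with radial
function `ρ_h`, and put `F(h) = ∫ φ(h) dμ + ∫ G(ρ_h(u), u) du`. For a measure `μ` not concentrated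
on a closed hemisphere, the body is found by minimizing `F` without any constraint.

*Existence.* The support function `h_{W(h)}` is at most `h` and has the same Wulff shape, so passing
to it does not increase `F`. A bound on `F` bounds `W(h)` from above, because `φ` is unbounded and
`μ` charges all caps around a given direction uniformly (`IsAdmissible.exists_wulffRadius_le`). It
also bounds support functions from below: if `h v` is small then `ρ_h` is small on the cap around
`v`, and the integral of `G` over this cap is large (`IsAdmissible.exists_pos_le_of_energy_le`). So
only functions between two positive constants with a common Lipschitz constant matter. They form a
compact set by Arzelà–Ascoli, and `F` is continuous on it (`IsAdmissible.exists_isMin_energy`).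

*Euler–Lagrange equation.* The gauge of a body is Lipschitz, so by Rademacher's theorem it is
differentiable in almost every direction `u`, and there its normalized gradient is the only outer
unit normal `α(u)`. In such directions the radius of `W(h (1 + t k))` has derivative `ρ_h(u) k(α(u))`
at `t = 0` (`hasDerivAt_wulffRadius_perturb`). At a minimizer this gives
`∫ ψ(h) k dμ = -∫ ρ G_t(ρ, u) k(α(u)) du` for every continuous `k`. With `k = f / ψ(h)`, and since
`h(α(u))` is the value of the support function of `W(h)` at `α(u)`, this says that `μ` is `-n` times
the curvature measure of `W(h)`.

*Converse.* The angle between `u` and `α(u)` is bounded away from `π/2`, so the directions close to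
`v` have their normals in the open hemisphere around `v`. As the density of the curvature measure is
negative everywhere, a negative multiple of this measure charges every open hemisphere.
-/

noncomputable section

namespace DualOrlicz

variable {n : ℕ}

/-! ### Normals and the gauge of a body -/

/-- A compact convex set with the origin in its interior, that is, a member of `𝓚ⁿ_(o)`. -/
structure IsOriginBody (K : Set (Space n)) : Prop where
  convex : Convex ℝ K
  compact : IsCompact K
  nhds : K ∈ 𝓝 0

variable {K : Set (Space n)}

lemma norm_sphere (u : Sphere n) : ‖(u : Space n)‖ = 1 := norm_eq_of_mem_sphere u

lemma sphere_ne_zero (u : Sphere n) : (u : Space n) ≠ 0 := by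
  rw [← norm_ne_zero_iff, norm_sphere]; exact one_ne_zero

namespace IsOriginBody

lemma zero_mem (hK : IsOriginBody K) : (0 : Space n) ∈ K := mem_of_mem_nhds hK.nhds

lemma gauge_pos (hK : IsOriginBody K) (u : Sphere n) : 0 < gauge K (u : Space n) :=
  (_root_.gauge_pos (absorbent_nhds_zero hK.nhds)
    (NormedSpace.isVonNBounded_of_isBounded ℝ hK.compact.isBounded)).2 (sphere_ne_zero u)

lemma mem_iff_gauge_le_one (hK : IsOriginBody K) (x : Space n) : x ∈ K ↔ gauge K x ≤ 1 := by
  rw [gauge_le_one_iff_mem_closure hK.convex hK.nhds, hK.compact.isClosed.closure_eq]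

lemma radialFunction_eq (hK : IsOriginBody K) (u : Sphere n) :
    radialFunction K (u : Space n) = (gauge K (u : Space n))⁻¹ := by
  have h : {c : ℝ | 0 ≤ c ∧ c • (u : Space n) ∈ K} = Icc 0 (gauge K (u : Space n))⁻¹ := by
    ext c
    simp only [mem_ofPred_eq, mem_Icc]
    refine and_congr_right fun hc => ?_
    rw [hK.mem_iff_gauge_le_one, gauge_smul_of_nonneg hc, smul_eq_mul, ← le_div_iff₀ (hK.gauge_pos u),
      one_div]
  rw [radialFunction, h, csSup_Icc (inv_nonneg.2 (gauge_nonneg _))]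

lemma radialFunction_pos (hK : IsOriginBody K) (u : Sphere n) :
    0 < radialFunction K (u : Space n) := by
  rw [hK.radialFunction_eq]; exact inv_pos.2 (hK.gauge_pos u)

lemma smul_mem_iff (hK : IsOriginBody K) (u : Sphere n) {c : ℝ} (hc : 0 ≤ c) :
    c • (u : Space n) ∈ K ↔ c ≤ radialFunction K (u : Space n) := by
  rw [hK.mem_iff_gauge_le_one, gauge_smul_of_nonneg hc, smul_eq_mul, ← le_div_iff₀ (hK.gauge_pos u),
    one_div, hK.radialFunction_eq]

lemma continuous_radialFunction (hK : IsOriginBody K) :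
    Continuous fun u : Sphere n => radialFunction K (u : Space n) := by
  simp_rw [hK.radialFunction_eq]
  exact ((continuous_gauge hK.convex hK.nhds).comp continuous_subtype_val).inv₀
    fun u => (hK.gauge_pos u).ne'

lemma radialMap_mem (hK : IsOriginBody K) (u : Sphere n) : radialMap K u ∈ K :=
  (hK.smul_mem_iff u (hK.radialFunction_pos u).le).2 le_rfl

lemma radialMap_mem_frontier (hK : IsOriginBody K) (u : Sphere n) :
    radialMap K u ∈ frontier K := by
  rw [← gauge_eq_one_iff_mem_frontier hK.convex hK.nhds, radialMap,
    gauge_smul_of_nonneg (hK.radialFunction_pos u).le, hK.radialFunction_eq, smul_eq_mul,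
    inv_mul_cancel₀ (hK.gauge_pos u).ne']

/-- Subadditivity of the gauge bounds its difference quotients in direction `z` by `gauge K z`. -/
lemma fderiv_gauge_le (hK : IsOriginBody K) {x : Space n}
    (hd : DifferentiableAt ℝ (gauge K) x) (z : Space n) :
    fderiv ℝ (gauge K) x z ≤ gauge K z := by
  have h1 : HasDerivAt (fun t : ℝ => gauge K (x + t • z)) (fderiv ℝ (gauge K) x z) 0 := by
    have h2 : HasFDerivAt (gauge K) (fderiv ℝ (gauge K) x) (x + (0 : ℝ) • z) := by
      simpa using hd.hasFDerivAt
    have h3 : HasDerivAt (fun t : ℝ => x + t • z) z 0 := by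
      simpa using ((hasDerivAt_id (0 : ℝ)).smul_const z).const_add x
    exact h2.comp_hasDerivAt (0 : ℝ) h3
  refine le_of_tendsto h1.tendsto_slope_zero_right ?_
  filter_upwards [self_mem_nhdsWithin] with t ht
  have ht : 0 < t := ht
  have h4 := gauge_add_le hK.convex (absorbent_nhds_zero hK.nhds) x (t • z)
  rw [gauge_smul_of_nonneg ht.le, smul_eq_mul] at h4
  simp only [zero_add, zero_smul, add_zero, smul_eq_mul]
  rw [inv_mul_le_iff₀ ht]
  linarith

/-- Euler's relation for the gauge, which is homogeneous of degree one. -/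
lemma fderiv_gauge_self {x : Space n} (hd : DifferentiableAt ℝ (gauge K) x) :
    fderiv ℝ (gauge K) x x = gauge K x := by
  have h2 : HasFDerivAt (gauge K) (fderiv ℝ (gauge K) x) ((1 : ℝ) • x) := by
    simpa using hd.hasFDerivAt
  have h3 : HasDerivAt (fun t : ℝ => t • x) x 1 := by
    simpa using (hasDerivAt_id (1 : ℝ)).smul_const x
  have h1 := h2.comp_hasDerivAt (1 : ℝ) h3
  have h4 : HasDerivAt (fun t : ℝ => t * gauge K x) (gauge K x) 1 := by
    simpa using (hasDerivAt_id (1 : ℝ)).mul_const (gauge K x)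
  refine h1.unique (h4.congr_of_eventuallyEq ?_)
  filter_upwards [lt_mem_nhds (zero_lt_one' ℝ)] with t ht
  simp [gauge_smul_of_nonneg ht.le]

lemma inner_le_mul_gauge (hK : IsOriginBody K) {v : Space n} {H : ℝ}
    (hv : ∀ x ∈ K, inner ℝ v x ≤ H) (z : Space n) : inner ℝ v z ≤ H * gauge K z := by
  rcases eq_or_ne z 0 with rfl | hz
  · simp
  · have hg : 0 < gauge K z := (_root_.gauge_pos (absorbent_nhds_zero hK.nhds)
      (NormedSpace.isVonNBounded_of_isBounded ℝ hK.compact.isBounded)).2 hz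
    have h1 : (gauge K z)⁻¹ • z ∈ K := by
      rw [hK.mem_iff_gauge_le_one, gauge_smul_of_nonneg (inv_nonneg.2 hg.le), smul_eq_mul,
        inv_mul_cancel₀ hg.ne']
    have h2 := hv _ h1
    rw [inner_smul_right, inv_mul_le_iff₀ hg] at h2
    linarith

end IsOriginBody

lemma mem_radialSphericalImage_singleton {u v : Sphere n} :
    v ∈ radialSphericalImage K {u} ↔ (v : Space n) ∈ normalCone K (radialMap K u) := by
  simp [radialSphericalImage, sphericalImage]

lemma mem_normalCone_iff {z y : Space n} :
    y ∈ normalCone K z ↔ ∀ x ∈ K, inner ℝ y x ≤ inner ℝ y z := by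
  simp [normalCone, inner_sub_right]

/-- The gradient of the gauge function of `K`. -/
def gaugeGradient (K : Set (Space n)) (x : Space n) : Space n :=
  (InnerProductSpace.toDual ℝ (Space n)).symm (fderiv ℝ (gauge K) x)

lemma inner_gaugeGradient (x z : Space n) :
    inner ℝ (gaugeGradient K x) z = fderiv ℝ (gauge K) x z :=
  InnerProductSpace.toDual_symm_apply

namespace IsOriginBody

lemma gaugeGradient_ne_zero (hK : IsOriginBody K) {u : Sphere n}
    (hd : DifferentiableAt ℝ (gauge K) (u : Space n)) : gaugeGradient K (u : Space n) ≠ 0 := by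
  intro h
  have h1 := inner_gaugeGradient (K := K) (u : Space n) u
  rw [h, inner_zero_left, fderiv_gauge_self hd] at h1
  exact (hK.gauge_pos u).ne h1

/-- Where the gauge is differentiable, its normalized gradient is the only outer unit normal. -/
lemma mem_normalCone_radialMap_iff (hK : IsOriginBody K) {u : Sphere n}
    (hd : DifferentiableAt ℝ (gauge K) (u : Space n)) (v : Sphere n) :
    (v : Space n) ∈ normalCone K (radialMap K u) ↔
      (v : Space n) = ‖gaugeGradient K (u : Space n)‖⁻¹ • gaugeGradient K (u : Space n) := by
  have hg := norm_pos_iff.2 (hK.gaugeGradient_ne_zero hd)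
  rw [mem_normalCone_iff]
  constructor
  · intro hv
    set H : ℝ := inner ℝ (v : Space n) (radialMap K u) with hH
    have hH0 : 0 ≤ H := by simpa using hv 0 hK.zero_mem
    have h1 := hK.inner_le_mul_gauge hv
    have h2 : inner ℝ (v : Space n) (u : Space n) = H * gauge K (u : Space n) := by
      rw [hH, radialMap, inner_smul_right, hK.radialFunction_eq]
      field_simp [(hK.gauge_pos u).ne']
    -- `H * gauge K - ⟪v, ·⟫` is nonnegative and vanishes at `u`, so its derivative there is zero.
    have h3 : IsLocalMin (fun z => H * gauge K z - innerSL ℝ (v : Space n) z) (u : Space n) := by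
      refine Filter.Eventually.of_forall fun z => ?_
      simp only [innerSL_apply_apply]
      rw [h2]
      linarith [h1 z]
    have h4 : HasFDerivAt (fun z => H * gauge K z - innerSL ℝ (v : Space n) z)
        (H • fderiv ℝ (gauge K) (u : Space n) - innerSL ℝ (v : Space n)) (u : Space n) :=
      (hd.hasFDerivAt.const_mul H).sub (innerSL ℝ (v : Space n)).hasFDerivAt
    have h5 := h3.hasFDerivAt_eq_zero h4
    have h6 : (v : Space n) = H • gaugeGradient K (u : Space n) := by
      refine ext_inner_right ℝ fun z => ?_
      rw [inner_smul_left, inner_gaugeGradient]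
      have := DFunLike.congr_fun h5 z
      simp only [sub_apply, smul_apply, smul_eq_mul, innerSL_apply_apply, zero_apply] at this
      simp only [conj_trivial]
      linarith
    have h7 : H * ‖gaugeGradient K (u : Space n)‖ = 1 := by
      have h := norm_sphere v
      rwa [h6, norm_smul, Real.norm_of_nonneg hH0] at h
    rw [← eq_inv_of_mul_eq_one_left h7]
    exact h6
  · intro hv x hx
    rw [hv, inner_smul_left, inner_smul_left, inner_gaugeGradient, inner_gaugeGradient]
    have h1 := (hK.fderiv_gauge_le hd x).trans ((hK.mem_iff_gauge_le_one x).1 hx)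
    have h2 : fderiv ℝ (gauge K) (u : Space n) (radialMap K u) = 1 := by
      rw [radialMap, map_smul, fderiv_gauge_self hd, hK.radialFunction_eq, smul_eq_mul,
        inv_mul_cancel₀ (hK.gauge_pos u).ne']
    rw [h2]
    simp only [conj_trivial]
    exact mul_le_mul_of_nonneg_left h1 (inv_nonneg.2 hg.le)

lemma radialSphericalImage_singleton (hK : IsOriginBody K) {u : Sphere n}
    (hd : DifferentiableAt ℝ (gauge K) (u : Space n)) :
    radialSphericalImage K {u} = {radialGaussMap K u} := by
  have hg := norm_pos_iff.2 (hK.gaugeGradient_ne_zero hd)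
  have h : ∃ v, radialSphericalImage K {u} = {v} := by
    refine ⟨⟨‖gaugeGradient K (u : Space n)‖⁻¹ • gaugeGradient K (u : Space n), ?_⟩, ?_⟩
    · simp [norm_smul, hg.ne']
    · ext v
      rw [mem_radialSphericalImage_singleton, hK.mem_normalCone_radialMap_iff hd]
      simp [Subtype.ext_iff]
  rw [radialGaussMap, dif_pos h]
  exact h.choose_spec

lemma mem_normalCone_radialMap_iff_eq (hK : IsOriginBody K) {u : Sphere n}
    (hd : DifferentiableAt ℝ (gauge K) (u : Space n)) (v : Sphere n) :
    (v : Space n) ∈ normalCone K (radialMap K u) ↔ v = radialGaussMap K u := by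
  rw [← mem_radialSphericalImage_singleton, hK.radialSphericalImage_singleton hd, mem_singleton_iff]

lemma radialGaussMap_eq (hK : IsOriginBody K) {u : Sphere n}
    (hd : DifferentiableAt ℝ (gauge K) (u : Space n)) :
    (radialGaussMap K u : Space n) =
      ‖gaugeGradient K (u : Space n)‖⁻¹ • gaugeGradient K (u : Space n) :=
  (hK.mem_normalCone_radialMap_iff hd _).1 ((hK.mem_normalCone_radialMap_iff_eq hd _).2 rfl)

lemma mem_reverseRadialSphericalImage_iff (hK : IsOriginBody K) {u : Sphere n}
    (hd : DifferentiableAt ℝ (gauge K) (u : Space n)) (E : Set (Sphere n)) :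
    u ∈ reverseRadialSphericalImage K E ↔ radialGaussMap K u ∈ E := by
  constructor
  · rintro ⟨-, v, hv, hvn⟩
    rwa [← (hK.mem_normalCone_radialMap_iff_eq hd v).1 hvn]
  · intro h
    exact ⟨hK.radialMap_mem_frontier u, _, h, (hK.mem_normalCone_radialMap_iff_eq hd _).2 rfl⟩

/-- By Rademacher's theorem, the gauge is differentiable in almost every direction. -/
lemma ae_differentiableAt_gauge (hK : IsOriginBody K) :
    ∀ᵐ u : Sphere n ∂surfaceMeasure n, DifferentiableAt ℝ (gauge K) (u : Space n) := by
  obtain ⟨C, hC⟩ := hK.convex.lipschitz_gauge hK.nhds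
  have h0 : volume {x : Space n | ¬ DifferentiableAt ℝ (gauge K) x} = 0 := hC.ae_differentiableAt
  have hm : MeasurableSet {u : Sphere n | ¬ DifferentiableAt ℝ (gauge K) (u : Space n)} :=
    measurable_subtype_coe (measurableSet_of_differentiableAt ℝ (gauge K)).compl
  rw [ae_iff, surfaceMeasure, Measure.toSphere_apply' _ hm]
  refine mul_eq_zero_of_right _ (measure_mono_null ?_ h0)
  rintro _ ⟨t, ht, _, ⟨u, hu, rfl⟩, rfl⟩ hd
  have hd' : DifferentiableAt ℝ (gauge K) (t • (u : Space n)) := hd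
  refine hu ?_
  have h1 : gauge K = fun y => t⁻¹ * gauge K (t • y) := by
    ext y
    rw [gauge_smul_of_nonneg ht.1.le, smul_eq_mul, inv_mul_cancel_left₀ ht.1.ne']
  rw [h1]
  refine DifferentiableAt.const_mul ?_ _
  exact hd'.comp (u : Space n) (differentiableAt_id.const_smul t)

lemma aemeasurable_radialGaussMap (hK : IsOriginBody K) :
    AEMeasurable (radialGaussMap K) (surfaceMeasure n) := by
  have hs : MeasurableEmbedding ((↑) : Sphere n → Space n) :=
    MeasurableEmbedding.subtype_coe Metric.isClosed_sphere.measurableSet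
  rw [← hs.aemeasurable_comp_iff]
  have hg : Measurable (gaugeGradient K) :=
    (InnerProductSpace.toDual ℝ (Space n)).symm.continuous.measurable.comp
      (measurable_fderiv ℝ (gauge K))
  refine ⟨fun u => ‖gaugeGradient K (u : Space n)‖⁻¹ • gaugeGradient K (u : Space n),
    ((hg.norm.inv.smul hg).comp measurable_subtype_coe), ?_⟩
  filter_upwards [hK.ae_differentiableAt_gauge] with u hu
  exact hK.radialGaussMap_eq hu

end IsOriginBody

/-! ### Support functions and the curvature measure -/

lemma le_supportFunction (hK : IsCompact K) (u : Space n) {x : Space n} (hx : x ∈ K) :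
    inner ℝ u x ≤ supportFunction K u :=
  le_csSup (hK.image (by fun_prop : Continuous fun x : Space n => inner ℝ u x)).bddAbove
    ⟨x, hx, rfl⟩

lemma supportFunction_le (hne : K.Nonempty) {u : Space n} {c : ℝ}
    (h : ∀ x ∈ K, inner ℝ u x ≤ c) : supportFunction K u ≤ c :=
  csSup_le (hne.image _) (by rintro _ ⟨x, hx, rfl⟩; exact h x hx)

lemma supportFunction_le_add (hK : IsCompact K) (hne : K.Nonempty) {R : ℝ}
    (hR : ∀ x ∈ K, ‖x‖ ≤ R) (v w : Space n) :
    supportFunction K v ≤ supportFunction K w + R * ‖v - w‖ := by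
  refine supportFunction_le hne fun x hx => ?_
  have h1 := le_supportFunction hK w hx
  have h2 : inner ℝ v x = inner ℝ w x + inner ℝ (v - w) x := by rw [inner_sub_left]; ring
  have h3 := real_inner_le_norm (v - w) x
  have h4 := mul_le_mul_of_nonneg_left (hR x hx) (norm_nonneg (v - w))
  linarith

lemma lipschitzWith_supportFunction (hK : IsCompact K) (hne : K.Nonempty) {R : NNReal}
    (hR : ∀ x ∈ K, ‖x‖ ≤ R) : LipschitzWith R (supportFunction K) :=
  LipschitzWith.of_le_add_mul R fun v w => by
    rw [dist_eq_norm]; exact supportFunction_le_add hK hne hR v w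

namespace IsOriginBody

lemma nonempty (hK : IsOriginBody K) : K.Nonempty := ⟨0, hK.zero_mem⟩

lemma continuous_supportFunction (hK : IsOriginBody K) : Continuous (supportFunction K) := by
  obtain ⟨R, hR⟩ := hK.compact.isBounded.exists_norm_le
  exact (lipschitzWith_supportFunction hK.compact hK.nonempty (R := R.toNNReal)
    fun x hx => (hR x hx).trans (Real.le_coe_toNNReal R)).continuous

lemma radialFunction_le_supportFunction (hK : IsOriginBody K) (u : Sphere n) :
    radialFunction K (u : Space n) ≤ supportFunction K (u : Space n) := by
  have h := le_supportFunction hK.compact (u : Space n) (hK.radialMap_mem u)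
  rwa [radialMap, inner_smul_right, real_inner_self_eq_norm_sq, norm_sphere, one_pow, mul_one] at h

lemma supportFunction_pos (hK : IsOriginBody K) (u : Sphere n) :
    0 < supportFunction K (u : Space n) :=
  (hK.radialFunction_pos u).trans_le (hK.radialFunction_le_supportFunction u)

lemma supportFunction_radialGaussMap (hK : IsOriginBody K) {u : Sphere n}
    (hd : DifferentiableAt ℝ (gauge K) (u : Space n)) :
    supportFunction K (radialGaussMap K u : Space n) =
      radialFunction K (u : Space n) * inner ℝ (radialGaussMap K u : Space n) (u : Space n) := by
  have h1 := (hK.mem_normalCone_radialMap_iff_eq hd _).2 rfl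
  rw [mem_normalCone_iff] at h1
  rw [← inner_smul_right]
  exact le_antisymm (supportFunction_le hK.nonempty h1)
    (le_supportFunction hK.compact _ (hK.radialMap_mem u))

end IsOriginBody

/-- The integrand of the general dual Orlicz curvature measure. -/
def curvatureDensity (G : ℝ → Sphere n → ℝ) (ψ : ℝ → ℝ) (K : Set (Space n)) (u : Sphere n) : ℝ :=
  radialFunction K (u : Space n) * partialT G (radialFunction K (u : Space n)) u /
    ψ (supportFunction K (radialGaussMap K u : Space n))

instance : IsFiniteMeasure (surfaceMeasure n) := by
  unfold surfaceMeasure; infer_instance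

instance : (surfaceMeasure n).IsOpenPosMeasure := by
  unfold surfaceMeasure; infer_instance

/-- A function continuous on `(0, ∞) × S^{n-1}` is continuous along a positive continuous radius. -/
lemma continuous_uncurry_comp {g : ℝ → Sphere n → ℝ}
    (hg : ContinuousOn (Function.uncurry g) (Ioi 0 ×ˢ univ)) {r : Sphere n → ℝ}
    (hr : Continuous r) (hpos : ∀ u, 0 < r u) : Continuous fun u => g (r u) u :=
  hg.comp_continuous (f := fun u => (r u, u)) (by fun_prop) fun u => ⟨hpos u, mem_univ _⟩

lemma integrable_of_continuous {ν : Measure (Sphere n)} [IsFiniteMeasure ν] {f : Sphere n → ℝ}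
    (hf : Continuous f) : Integrable f ν := by
  obtain ⟨C, hC⟩ := isCompact_univ.exists_bound_of_continuousOn hf.continuousOn
  exact Integrable.of_bound hf.aestronglyMeasurable C (Eventually.of_forall fun u => hC u (mem_univ u))

lemma exists_pos_le_of_continuous {f : Sphere n → ℝ} (hf : Continuous f) (hpos : ∀ u, 0 < f u) :
    ∃ c, 0 < c ∧ ∀ u, c ≤ f u := by
  rcases isEmpty_or_nonempty (Sphere n) with h | h
  · exact ⟨1, one_pos, fun u => h.elim u⟩
  · obtain ⟨w, -, hw⟩ := isCompact_univ.exists_isMinOn univ_nonempty hf.continuousOn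
    exact ⟨f w, hpos w, fun u => hw (mem_univ u)⟩

lemma exists_pos_norm_le_of_continuous {f : Sphere n → ℝ} (hf : Continuous f) :
    ∃ C, 0 < C ∧ ∀ u, |f u| ≤ C := by
  obtain ⟨C, hC⟩ := isCompact_univ.exists_bound_of_continuousOn hf.continuousOn
  exact ⟨max C 1, by positivity, fun u => (hC u (mem_univ u)).trans (le_max_left _ _)⟩

section Density

variable {G : ℝ → Sphere n → ℝ} {ψ : ℝ → ℝ}

lemma IsOriginBody.curvatureDensity_neg (hK : IsOriginBody K)
    (hGtneg : ∀ t : ℝ, 0 < t → ∀ u, partialT G t u < 0) (hψpos : ∀ t : ℝ, 0 < t → 0 < ψ t)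
    (u : Sphere n) : curvatureDensity G ψ K u < 0 :=
  div_neg_of_neg_of_pos
    (mul_neg_of_pos_of_neg (hK.radialFunction_pos u) (hGtneg _ (hK.radialFunction_pos u) u))
    (hψpos _ (hK.supportFunction_pos _))

lemma IsOriginBody.integrable_curvatureDensity (hK : IsOriginBody K)
    (hGtcont : ContinuousOn (Function.uncurry (partialT G)) (Ioi 0 ×ˢ univ))
    (hψcont : ContinuousOn ψ (Ioi 0)) (hψpos : ∀ t : ℝ, 0 < t → 0 < ψ t) :
    Integrable (curvatureDensity G ψ K) (surfaceMeasure n) := by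
  have h1 : Continuous fun u : Sphere n =>
      radialFunction K (u : Space n) * partialT G (radialFunction K (u : Space n)) u :=
    hK.continuous_radialFunction.mul
      (continuous_uncurry_comp hGtcont hK.continuous_radialFunction hK.radialFunction_pos)
  have h2 : Continuous fun v : Sphere n => (ψ (supportFunction K (v : Space n)))⁻¹ :=
    (hψcont.comp_continuous (hK.continuous_supportFunction.comp continuous_subtype_val)
      hK.supportFunction_pos).inv₀ fun v => (hψpos _ (hK.supportFunction_pos v)).ne'
  obtain ⟨C, hC⟩ := isCompact_univ.exists_bound_of_continuousOn h2.continuousOn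
  refine (integrable_of_continuous h1).mul_bdd (c := C)
    (h2.measurable.comp_aemeasurable hK.aemeasurable_radialGaussMap).aestronglyMeasurable
    (Eventually.of_forall fun u => hC (radialGaussMap K u) (mem_univ _))

lemma IsOriginBody.reverseRadialSphericalImage_ae_eq (hK : IsOriginBody K) (E : Set (Sphere n)) :
    reverseRadialSphericalImage K E =ᵐ[surfaceMeasure n] radialGaussMap K ⁻¹' E := by
  filter_upwards [hK.ae_differentiableAt_gauge] with u hu
  exact propext (hK.mem_reverseRadialSphericalImage_iff hu E)

lemma IsOriginBody.dualOrliczCurvature_eq (hK : IsOriginBody K) (E : Set (Sphere n)) :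
    dualOrliczCurvature G ψ K E =
      (1 / (n : ℝ)) * ∫ u in radialGaussMap K ⁻¹' E, curvatureDensity G ψ K u ∂surfaceMeasure n := by
  rw [← setIntegral_congr_set (hK.reverseRadialSphericalImage_ae_eq E)]
  rfl

/-- The angle between a direction and the outer normal there is bounded away from a right angle,
so directions near `v` have outer normals in the open hemisphere centred at `v`. -/
lemma IsOriginBody.surfaceMeasure_preimage_hemisphere_pos (hK : IsOriginBody K) (v : Sphere n) :
    0 < surfaceMeasure n
      (radialGaussMap K ⁻¹' {w | 0 < inner ℝ (w : Space n) (v : Space n)}) := by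
  obtain ⟨c₁, hp₁, h₁⟩ := exists_pos_le_of_continuous
    (hK.continuous_supportFunction.comp continuous_subtype_val) hK.supportFunction_pos
  obtain ⟨c₂, hp₂, h₂⟩ := exists_pos_norm_le_of_continuous hK.continuous_radialFunction
  have hc0 : 0 < c₁ / c₂ := div_pos hp₁ hp₂
  set c := c₁ / c₂ with hc
  refine (Metric.measure_ball_pos (surfaceMeasure n) v hc0).trans_le (measure_mono_ae ?_)
  filter_upwards [hK.ae_differentiableAt_gauge] with u hu hub
  set a : Sphere n := radialGaussMap K u with ha
  have e1 : c ≤ inner ℝ (a : Space n) (u : Space n) := by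
    have e2 := hK.supportFunction_radialGaussMap hu
    rw [← ha] at e2
    have e3 : c₁ ≤ supportFunction K (a : Space n) := h₁ a
    have e4 := (le_abs_self _).trans (h₂ u)
    have e5 := hK.radialFunction_pos u
    have e6 : 0 < inner ℝ (a : Space n) (u : Space n) :=
      pos_of_mul_pos_right (e2 ▸ hK.supportFunction_pos a) e5.le
    rw [hc, div_le_iff₀ hp₂]
    nlinarith
  have e7 : ‖(u : Space n) - v‖ < c := by
    have := Metric.mem_ball.1 hub
    rwa [Subtype.dist_eq, dist_eq_norm] at this
  have e8 := real_inner_le_norm (a : Space n) ((u : Space n) - v)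
  rw [inner_sub_right, norm_sphere, one_mul] at e8
  change 0 < inner ℝ (a : Space n) (v : Space n)
  linarith

/-- A negative multiple of the curvature measure of a body charges every open hemisphere. -/
lemma IsOriginBody.notConcentrated_of_eq_curvature (hK : IsOriginBody K) (hn : 1 ≤ n)
    (hGtcont : ContinuousOn (Function.uncurry (partialT G)) (Ioi 0 ×ˢ univ))
    (hGtneg : ∀ t : ℝ, 0 < t → ∀ u, partialT G t u < 0)
    (hψcont : ContinuousOn ψ (Ioi 0)) (hψpos : ∀ t : ℝ, 0 < t → 0 < ψ t)
    {μ : Measure (Sphere n)} [IsFiniteMeasure μ] {τ : ℝ} (hτ : τ < 0)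
    (h : ∀ E : Set (Sphere n), MeasurableSet E → μ.real E = τ * dualOrliczCurvature G ψ K E) :
    NotConcentratedOnHemisphere μ := by
  intro v
  have hcont : Continuous fun w : Sphere n => inner ℝ (w : Space n) (v : Space n) := by fun_prop
  have hE : MeasurableSet {w : Sphere n | 0 < inner ℝ (w : Space n) (v : Space n)} :=
    (isOpen_lt continuous_const hcont).measurableSet
  have h1 := hK.surfaceMeasure_preimage_hemisphere_pos v
  have h2 := h _ hE
  rw [hK.dualOrliczCurvature_eq] at h2
  have h3 : 0 < ∫ u in radialGaussMap K ⁻¹' {w | 0 < inner ℝ (w : Space n) (v : Space n)},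
      -curvatureDensity G ψ K u ∂surfaceMeasure n := by
    rw [integral_pos_iff_support_of_nonneg
      (fun u => (neg_pos.2 (hK.curvatureDensity_neg hGtneg hψpos u)).le)
      (hK.integrable_curvatureDensity hGtcont hψcont hψpos).neg.integrableOn]
    have : (Function.support fun u => -curvatureDensity G ψ K u) = univ :=
      eq_univ_of_forall fun u => (neg_pos.2 (hK.curvatureDensity_neg hGtneg hψpos u)).ne'
    rwa [this, Measure.restrict_apply_univ]
  rw [integral_neg] at h3
  have h4 : 0 < μ.real {w : Sphere n | 0 < inner ℝ (w : Space n) (v : Space n)} := by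
    rw [h2]
    have : (0 : ℝ) < 1 / n := by positivity
    nlinarith [mul_pos this h3]
  have h5 : (Function.support fun u : Sphere n => max (inner ℝ (u : Space n) (v : Space n)) 0) =
      {w : Sphere n | 0 < inner ℝ (w : Space n) (v : Space n)} := by
    ext w
    simp [Function.mem_support]
  refine (integral_pos_iff_support_of_nonneg
    (f := fun u : Sphere n => max (inner ℝ (u : Space n) (v : Space n)) 0)
    (fun u => le_max_right _ _) (integrable_of_continuous (by fun_prop))).2 ?_
  rw [h5]
  exact (ENNReal.toReal_pos_iff.1 h4).1

end Density

/-! ### Wulff shapes and their perturbations -/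

/-- The Wulff shape `{x : ⟨v, x⟩ ≤ h v for all v}` of a function `h` on the sphere. -/
def wulffShape (h : Sphere n → ℝ) : Set (Space n) :=
  {x | ∀ v : Sphere n, inner ℝ (v : Space n) x ≤ h v}

/-- The radial function of the Wulff shape of `h`. -/
def wulffRadius (h : Sphere n → ℝ) (u : Sphere n) : ℝ := radialFunction (wulffShape h) (u : Space n)

lemma norm_le_of_forall_inner_le {x : Space n} {R : ℝ} (hR : 0 ≤ R)
    (hx : ∀ v : Sphere n, inner ℝ (v : Space n) x ≤ R) : ‖x‖ ≤ R := by
  rcases eq_or_ne x 0 with rfl | h0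
  · simpa using hR
  · have hpos := norm_pos_iff.2 h0
    have h1 := hx ⟨‖x‖⁻¹ • x, by simp [norm_smul, hpos.ne']⟩
    simp only [inner_smul_left, real_inner_self_eq_norm_sq, conj_trivial] at h1
    rwa [pow_two, inv_mul_cancel_left₀ hpos.ne'] at h1

lemma isOriginBody_wulffShape {h : Sphere n → ℝ} (hc : Continuous h) (hp : ∀ v, 0 < h v) :
    IsOriginBody (wulffShape h) := by
  have hset : wulffShape h = ⋂ v : Sphere n, {x : Space n | inner ℝ (v : Space n) x ≤ h v} := by
    ext x; simp [wulffShape]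
  refine ⟨?_, ?_, ?_⟩
  · rw [hset]
    exact convex_iInter fun v => convex_halfSpace_le (innerSL ℝ (v : Space n)).toLinearMap.isLinear _
  · obtain ⟨C, hC0, hC⟩ := exists_pos_norm_le_of_continuous hc
    refine Metric.isCompact_of_isClosed_isBounded ?_ ?_
    · rw [hset]
      exact isClosed_iInter fun v => isClosed_le (by fun_prop) continuous_const
    · exact isBounded_iff_forall_norm_le.2 ⟨C, fun x hx =>
        norm_le_of_forall_inner_le hC0.le fun v => (hx v).trans ((le_abs_self _).trans (hC v))⟩
  · obtain ⟨c, hc0, hle⟩ := exists_pos_le_of_continuous hc hp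
    refine Filter.mem_of_superset (Metric.ball_mem_nhds 0 hc0) fun x hx v => ?_
    have h1 := real_inner_le_norm (v : Space n) x
    rw [norm_sphere, one_mul] at h1
    exact h1.trans ((mem_ball_zero_iff.1 hx).le.trans (hle v))

lemma mem_normalCone_of_wulffRadius_mul_inner_eq {h : Sphere n → ℝ} {u v : Sphere n}
    (hv : wulffRadius h u * inner ℝ (v : Space n) (u : Space n) = h v) :
    (v : Space n) ∈ normalCone (wulffShape h) (radialMap (wulffShape h) u) := by
  rw [mem_normalCone_iff]
  intro x hx
  rw [radialMap, inner_smul_right]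
  exact (hx v).trans hv.ge

section Radius

variable {h : Sphere n → ℝ} (hc : Continuous h) (hp : ∀ v, 0 < h v)
include hc hp

lemma wulffRadius_pos (u : Sphere n) : 0 < wulffRadius h u :=
  (isOriginBody_wulffShape hc hp).radialFunction_pos u

lemma continuous_wulffRadius : Continuous (wulffRadius h) :=
  (isOriginBody_wulffShape hc hp).continuous_radialFunction

lemma le_wulffRadius_iff (u : Sphere n) {c : ℝ} (hc0 : 0 ≤ c) :
    c ≤ wulffRadius h u ↔ ∀ v : Sphere n, c * inner ℝ (v : Space n) (u : Space n) ≤ h v := by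
  rw [wulffRadius, ← (isOriginBody_wulffShape hc hp).smul_mem_iff u hc0]
  simp [wulffShape, inner_smul_right]

lemma wulffRadius_mul_inner_le (u v : Sphere n) :
    wulffRadius h u * inner ℝ (v : Space n) (u : Space n) ≤ h v :=
  (le_wulffRadius_iff hc hp u (wulffRadius_pos hc hp u).le).1 le_rfl v

lemma le_wulffRadius {c : ℝ} (hc0 : 0 ≤ c) (hle : ∀ v, c ≤ h v) (u : Sphere n) :
    c ≤ wulffRadius h u := by
  rw [le_wulffRadius_iff hc hp u hc0]
  intro v
  have h1 := real_inner_le_norm (v : Space n) (u : Space n)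
  rw [norm_sphere, norm_sphere, one_mul] at h1
  nlinarith [hle v]

lemma wulffRadius_le (u : Sphere n) : wulffRadius h u ≤ h u := by
  have h1 := wulffRadius_mul_inner_le hc hp u u
  rwa [real_inner_self_eq_norm_sq, norm_sphere, one_pow, mul_one] at h1

lemma wulffRadius_mul_le {h' : Sphere n → ℝ} (hc' : Continuous h') (hp' : ∀ v, 0 < h' v)
    {a : ℝ} (ha : 0 ≤ a) (hle : ∀ v, a * h v ≤ h' v) (u : Sphere n) :
    a * wulffRadius h u ≤ wulffRadius h' u := by
  rw [le_wulffRadius_iff hc' hp' u (mul_nonneg ha (wulffRadius_pos hc hp u).le)]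
  intro v
  rw [mul_assoc]
  exact (mul_le_mul_of_nonneg_left (wulffRadius_mul_inner_le hc hp u v) ha).trans (hle v)

/-- The boundary point of a Wulff shape in direction `u` lies on one of the hyperplanes that
define the shape. -/
lemma exists_wulffRadius_mul_inner_eq (u : Sphere n) :
    ∃ v : Sphere n, wulffRadius h u * inner ℝ (v : Space n) (u : Space n) = h v := by
  by_contra! hne
  obtain ⟨c, hc0, hle⟩ := exists_pos_le_of_continuous
    (f := fun v : Sphere n => h v - wulffRadius h u * inner ℝ (v : Space n) (u : Space n))
    (by fun_prop) fun v => sub_pos.2 (lt_of_le_of_ne (wulffRadius_mul_inner_le hc hp u v) (hne v))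
  have h1 : wulffRadius h u + c ≤ wulffRadius h u := by
    rw [le_wulffRadius_iff hc hp u (by linarith [wulffRadius_pos hc hp u])]
    intro v
    have h1 := real_inner_le_norm (v : Space n) (u : Space n)
    rw [norm_sphere, norm_sphere, one_mul] at h1
    nlinarith [hle v]
  linarith

/-- In directions of differentiability of the gauge, the hyperplane through the boundary point is
the one normal to the radial Gauss image. -/
lemma wulffRadius_mul_inner_eq_iff {u : Sphere n}
    (hd : DifferentiableAt ℝ (gauge (wulffShape h)) (u : Space n)) (v : Sphere n) :
    wulffRadius h u * inner ℝ (v : Space n) (u : Space n) = h v ↔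
      v = radialGaussMap (wulffShape h) u := by
  have key : ∀ w : Sphere n, wulffRadius h u * inner ℝ (w : Space n) (u : Space n) = h w →
      w = radialGaussMap (wulffShape h) u := fun w hw =>
    ((isOriginBody_wulffShape hc hp).mem_normalCone_radialMap_iff_eq hd w).1
      (mem_normalCone_of_wulffRadius_mul_inner_eq hw)
  refine ⟨key v, ?_⟩
  rintro rfl
  obtain ⟨w, hw⟩ := exists_wulffRadius_mul_inner_eq hc hp u
  rwa [← key w hw]

lemma supportFunction_wulffShape_le (v : Sphere n) :
    supportFunction (wulffShape h) (v : Space n) ≤ h v :=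
  supportFunction_le (isOriginBody_wulffShape hc hp).nonempty fun _ hx => hx v

lemma wulffShape_supportFunction :
    wulffShape (fun v : Sphere n => supportFunction (wulffShape h) (v : Space n)) =
      wulffShape h := by
  refine Subset.antisymm (fun x hx v => (hx v).trans (supportFunction_wulffShape_le hc hp v))
    fun x hx v => le_supportFunction (isOriginBody_wulffShape hc hp).compact _ hx

lemma supportFunction_radialGaussMap_wulffShape {u : Sphere n}
    (hd : DifferentiableAt ℝ (gauge (wulffShape h)) (u : Space n)) :
    supportFunction (wulffShape h) (radialGaussMap (wulffShape h) u : Space n) =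
      h (radialGaussMap (wulffShape h) u) := by
  rw [(isOriginBody_wulffShape hc hp).supportFunction_radialGaussMap hd]
  exact (wulffRadius_mul_inner_eq_iff hc hp hd _).2 rfl

end Radius

/-- The multiplicative perturbation `h (1 + t k)` of `h` in direction `k`. -/
def perturb (h k : Sphere n → ℝ) (t : ℝ) (v : Sphere n) : ℝ := h v * (1 + t * k v)

section Perturb

variable {h k : Sphere n → ℝ}

lemma perturb_zero : perturb h k 0 = h := by ext v; simp [perturb]

lemma continuous_perturb (hc : Continuous h) (hk : Continuous k) (t : ℝ) :
    Continuous (perturb h k t) := by unfold perturb; fun_prop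

lemma abs_mul_le_of_abs_le {B t x : ℝ} (hx : |x| ≤ B) : |t * x| ≤ |t| * B := by
  rw [abs_mul]; exact mul_le_mul_of_nonneg_left hx (abs_nonneg _)

lemma perturb_pos (hp : ∀ v, 0 < h v) {B : ℝ} (hB : ∀ v, |k v| ≤ B) {t : ℝ} (ht : |t| * B < 1)
    (v : Sphere n) : 0 < perturb h k t v := by
  have := abs_le.1 (abs_mul_le_of_abs_le (t := t) (hB v))
  exact mul_pos (hp v) (by linarith)

lemma abs_wulffRadius_perturb_sub_le (hc : Continuous h) (hp : ∀ v, 0 < h v) (hk : Continuous k)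
    {B : ℝ} (hB : ∀ v, |k v| ≤ B) {t : ℝ} (ht : |t| * B < 1) (u : Sphere n) :
    |wulffRadius (perturb h k t) u - wulffRadius h u| ≤ |t| * B * wulffRadius h u := by
  have hB0 : 0 ≤ B := (abs_nonneg _).trans (hB u)
  have h0 : 0 ≤ |t| * B := by positivity
  have hc' := continuous_perturb hc hk t
  have hp' := perturb_pos hp hB ht
  have h1 : (1 - |t| * B) * wulffRadius h u ≤ wulffRadius (perturb h k t) u := by
    refine wulffRadius_mul_le hc hp hc' hp' (by linarith) (fun v => ?_) u
    have := abs_le.1 (abs_mul_le_of_abs_le (t := t) (hB v))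
    rw [perturb, mul_comm]
    exact mul_le_mul_of_nonneg_left (by linarith) (hp v).le
  have h2 : (1 + |t| * B)⁻¹ * wulffRadius (perturb h k t) u ≤ wulffRadius h u := by
    refine wulffRadius_mul_le hc' hp' hc hp (by positivity) (fun v => ?_) u
    have := abs_le.1 (abs_mul_le_of_abs_le (t := t) (hB v))
    rw [inv_mul_le_iff₀ (by positivity), perturb, mul_comm (1 + |t| * B)]
    exact mul_le_mul_of_nonneg_left (by linarith) (hp v).le
  rw [inv_mul_le_iff₀ (by positivity)] at h2
  rw [abs_le]
  constructor <;> linarith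

/-- An envelope theorem: the radius `ρ_t(u)` of the perturbed Wulff shape is the minimum over `v` of
`h v (1 + t k v) / ⟨v, u⟩`, and its derivative at `t = 0` is that of the term at the only
minimizer `v = α(u)`. -/
lemma hasDerivAt_wulffRadius_perturb (hc : Continuous h) (hp : ∀ v, 0 < h v) (hk : Continuous k)
    {u : Sphere n} (hd : DifferentiableAt ℝ (gauge (wulffShape h)) (u : Space n)) :
    HasDerivAt (fun t => wulffRadius (perturb h k t) u)
      (wulffRadius h u * k (radialGaussMap (wulffShape h) u)) 0 := by
  obtain ⟨B, hB0, hB⟩ := exists_pos_norm_le_of_continuous hk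
  obtain ⟨R, hR0, hR⟩ := exists_pos_norm_le_of_continuous hc
  have hρ := wulffRadius_pos hc hp u
  set ρ := wulffRadius h u with hρdef
  set a := radialGaussMap (wulffShape h) u with ha
  have hau : ρ * inner ℝ (a : Space n) (u : Space n) = h a :=
    (wulffRadius_mul_inner_eq_iff hc hp hd a).2 rfl
  have hau_pos : 0 < inner ℝ (a : Space n) (u : Space n) :=
    pos_of_mul_pos_right (hau ▸ hp a) hρ.le
  rw [hasDerivAt_iff_isLittleO, Asymptotics.isLittleO_iff]
  intro ε hε
  -- A minimizer `v` for the parameter `t` gives `ρ (1 + t k v) ≤ ρ_t ≤ ρ (1 + t k a)`, so it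
  -- suffices that `k v` is within `ε / ρ` of `k a` for small `t`.
  -- Away from the Gauss image, the defining inequalities hold with a uniform slack `m`.
  obtain ⟨m, hm0, hm⟩ : ∃ m, 0 < m ∧ ∀ v : Sphere n, ε / ρ ≤ |k v - k a| →
      m ≤ h v - ρ * inner ℝ (v : Space n) (u : Space n) := by
    have hA : IsCompact {v : Sphere n | ε / ρ ≤ |k v - k a|} :=
      (isClosed_le continuous_const (by fun_prop)).isCompact
    rcases eq_empty_or_nonempty {v : Sphere n | ε / ρ ≤ |k v - k a|} with he | hne
    · exact ⟨1, one_pos, fun v hv => absurd (show v ∈ {v : Sphere n | ε / ρ ≤ |k v - k a|} from hv)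
        (by simp [he])⟩
    · obtain ⟨w, hw, hmin⟩ := hA.exists_isMinOn hne
        (f := fun v : Sphere n => h v - ρ * inner ℝ (v : Space n) (u : Space n)) (by fun_prop)
      refine ⟨_, ?_, fun v hv => hmin hv⟩
      refine sub_pos.2 (lt_of_le_of_ne (wulffRadius_mul_inner_le hc hp u w) fun he => ?_)
      have hwa := (wulffRadius_mul_inner_eq_iff hc hp hd w).1 he
      have hw' : ε / ρ ≤ |k w - k a| := hw
      rw [hwa, ← ha, sub_self, abs_zero] at hw'
      exact absurd hw' (not_le.2 (div_pos hε hρ))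
  have hev : ∀ᶠ t : ℝ in 𝓝 0, |t| * B < 1 ∧ |t| * B * (R + ρ) < m := by
    refine Filter.Eventually.and ?_ ?_
    · exact (show Continuous fun t : ℝ => |t| * B by fun_prop).continuousAt.eventually_lt
        continuousAt_const (by simp)
    · exact (show Continuous fun t : ℝ => |t| * B * (R + ρ) by fun_prop).continuousAt.eventually_lt
        continuousAt_const (by simpa using hm0)
  filter_upwards [hev] with t ht
  obtain ⟨ht1, ht2⟩ := ht
  have hc' := continuous_perturb hc hk t
  have hp' := perturb_pos hp hB ht1
  have hρ' := wulffRadius_pos hc' hp' u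
  have habs := abs_le.1 (abs_wulffRadius_perturb_sub_le hc hp hk hB ht1 u)
  rw [← hρdef] at habs
  rw [perturb_zero, ← hρdef]
  set ρ' := wulffRadius (perturb h k t) u with hρ'def
  have hup : ρ' ≤ ρ * (1 + t * k a) := by
    have h1 := wulffRadius_mul_inner_le hc' hp' u a
    rw [← hρ'def, perturb, ← hau] at h1
    refine le_of_mul_le_mul_right ?_ hau_pos
    linarith
  obtain ⟨v, hv⟩ := exists_wulffRadius_mul_inner_eq hc' hp' u
  rw [← hρ'def] at hv
  have hvu : 0 < inner ℝ (v : Space n) (u : Space n) :=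
    pos_of_mul_pos_right (hv ▸ hp' v) hρ'.le
  have hle := wulffRadius_mul_inner_le hc hp u v
  rw [← hρdef] at hle
  have htk := abs_le.1 (abs_mul_le_of_abs_le (t := t) (hB v))
  have hlow : ρ * (1 + t * k v) ≤ ρ' := by
    refine le_of_mul_le_mul_right ?_ hvu
    rw [hv, perturb]
    have : 0 ≤ 1 + t * k v := by linarith
    nlinarith
  have hkv : |k v - k a| < ε / ρ := by
    by_contra! hcon
    have h1 := hm v hcon
    have h2 := real_inner_le_norm (v : Space n) (u : Space n)
    rw [norm_sphere, norm_sphere, one_mul] at h2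
    have h3 := (le_abs_self _).trans (hR v)
    have h4 : 0 ≤ |t| * B := by positivity
    have h5 := hp v
    rw [perturb] at hv
    have h6 : ρ' * inner ℝ (v : Space n) (u : Space n) ≤
        ρ * inner ℝ (v : Space n) (u : Space n) + |t| * B * ρ := by
      have : (ρ' - ρ) * inner ℝ (v : Space n) (u : Space n) ≤ |t| * B * ρ * 1 :=
        mul_le_mul habs.2 h2 hvu.le (by positivity)
      linarith
    have h7 : -(|t| * B * R) ≤ h v * (t * k v) := by
      have h8 := mul_le_mul_of_nonneg_left htk.1 h5.le
      have h9 := mul_le_mul_of_nonneg_right h3 h4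
      linarith
    nlinarith
  simp only [sub_zero, smul_eq_mul, Real.norm_eq_abs]
  have h1 : |ρ * (t * (k v - k a))| ≤ ε * |t| := by
    rw [abs_mul, abs_mul, abs_of_pos hρ]
    have := (lt_div_iff₀ hρ).1 hkv
    nlinarith [abs_nonneg t]
  have h2 := neg_le_of_abs_le h1
  rw [abs_le]
  constructor
  · linarith
  · have : 0 ≤ ε * |t| := by positivity
    linarith

end Perturb

/-! ### Integrals over radial functions, and the function `φ` -/

section Composition

variable {g g' : ℝ → Sphere n → ℝ}

lemma exists_lipschitz_of_hasDerivAt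
    (hd : ∀ t : ℝ, 0 < t → ∀ u, HasDerivAt (fun s => g s u) (g' t u) t)
    (hg' : ContinuousOn (Function.uncurry g') (Ioi 0 ×ˢ univ)) {a b : ℝ} (ha : 0 < a) :
    ∃ L, 0 ≤ L ∧ ∀ s ∈ Icc a b, ∀ t ∈ Icc a b, ∀ u, |g t u - g s u| ≤ L * |t - s| := by
  have hK : IsCompact (Icc a b ×ˢ (univ : Set (Sphere n))) := isCompact_Icc.prod isCompact_univ
  obtain ⟨L, hL⟩ := hK.exists_bound_of_continuousOn
    (hg'.mono (prod_mono (fun t ht => ha.trans_le ht.1) Subset.rfl))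
  refine ⟨max L 0, le_max_right _ _, fun s hs t ht u => ?_⟩
  exact (convex_Icc a b).norm_image_sub_le_of_norm_hasDerivWithin_le (f := fun s => g s u)
    (f' := fun s => g' s u)
    (fun x hx => (hd x (ha.trans_le hx.1) u).hasDerivWithinAt)
    (fun x hx => (hL (x, u) ⟨hx, mem_univ _⟩).trans (le_max_left _ _)) hs ht

lemma exists_lipschitz_integral (ν : Measure (Sphere n)) [IsFiniteMeasure ν]
    (hg : ContinuousOn (Function.uncurry g) (Ioi 0 ×ˢ univ))
    (hd : ∀ t : ℝ, 0 < t → ∀ u, HasDerivAt (fun s => g s u) (g' t u) t)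
    (hg' : ContinuousOn (Function.uncurry g') (Ioi 0 ×ˢ univ)) {a b : ℝ} (ha : 0 < a) :
    ∃ L, 0 ≤ L ∧ ∀ r₁ r₂ : Sphere n → ℝ, Continuous r₁ → Continuous r₂ →
      (∀ u, r₁ u ∈ Icc a b) → (∀ u, r₂ u ∈ Icc a b) → ∀ d, (∀ u, |r₁ u - r₂ u| ≤ d) →
      |∫ u, g (r₁ u) u ∂ν - ∫ u, g (r₂ u) u ∂ν| ≤ L * d := by
  obtain ⟨L, hL0, hL⟩ := exists_lipschitz_of_hasDerivAt hd hg' (b := b) ha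
  refine ⟨L * ν.real univ, by positivity, fun r₁ r₂ c₁ c₂ h₁ h₂ d h => ?_⟩
  rw [← integral_sub
    (integrable_of_continuous (continuous_uncurry_comp hg c₁ fun u => ha.trans_le (h₁ u).1))
    (integrable_of_continuous (continuous_uncurry_comp hg c₂ fun u => ha.trans_le (h₂ u).1))]
  have h1 := norm_integral_le_of_norm_le_const (μ := ν)
    (f := fun u => g (r₁ u) u - g (r₂ u) u) (C := L * d) (Eventually.of_forall fun u =>
      (hL _ (h₂ u) _ (h₁ u) u).trans (mul_le_mul_of_nonneg_left (h u) hL0))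
  rw [Real.norm_eq_abs] at h1
  linarith

/-- Differentiation of `∫ g(r_t(u), u) dν(u)` at `t = 0`. The radii `r_t(u)` need be
differentiable only at `t = 0` and only for almost every `u`, since near `t = 0` they satisfy a
Lipschitz estimate with base point `0`. -/
lemma hasDerivAt_integral_comp (ν : Measure (Sphere n)) [IsFiniteMeasure ν]
    (hg : ContinuousOn (Function.uncurry g) (Ioi 0 ×ˢ univ))
    (hd : ∀ t : ℝ, 0 < t → ∀ u, HasDerivAt (fun s => g s u) (g' t u) t)
    (hg' : ContinuousOn (Function.uncurry g') (Ioi 0 ×ˢ univ))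
    {r : ℝ → Sphere n → ℝ} {δ D : ℝ} (hδ : 0 < δ)
    (hr : ∀ t, |t| < δ → Continuous (r t)) (hpos : ∀ t, |t| < δ → ∀ u, 0 < r t u)
    (hlip : ∀ t, |t| < δ → ∀ u, |r t u - r 0 u| ≤ D * |t|)
    {r' : Sphere n → ℝ} (hmeas : AEStronglyMeasurable r' ν)
    (hr' : ∀ᵐ u ∂ν, HasDerivAt (fun t => r t u) (r' u) 0) :
    HasDerivAt (fun t => ∫ u, g (r t u) u ∂ν) (∫ u, g' (r 0 u) u * r' u ∂ν) 0 := by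
  have hr0 := hr 0 (by simpa using hδ)
  have hp0 := hpos 0 (by simpa using hδ)
  obtain ⟨a, ha0, ha⟩ := exists_pos_le_of_continuous hr0 hp0
  obtain ⟨b, hb0, hb⟩ := exists_pos_norm_le_of_continuous hr0
  obtain ⟨L, hL0, hL⟩ := exists_lipschitz_of_hasDerivAt hd hg' (b := b + a / 2)
    (show (0 : ℝ) < a / 2 by linarith)
  have hs : {t : ℝ | |t| < δ ∧ D * |t| < a / 2} ∈ 𝓝 (0 : ℝ) := by
    refine Filter.Eventually.and ?_ ?_
    · exact continuous_abs.continuousAt.eventually_lt continuousAt_const (by simpa using hδ)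
    · exact (show Continuous fun t : ℝ => D * |t| by fun_prop).continuousAt.eventually_lt
        continuousAt_const (by simpa using ha0)
  set F' : Sphere n → ℝ →L[ℝ] ℝ := fun u =>
    ContinuousLinearMap.smulRightL ℝ ℝ ℝ 1 (g' (r 0 u) u * r' u) with hF'
  have hm : AEStronglyMeasurable (fun u => g' (r 0 u) u * r' u) ν :=
    (continuous_uncurry_comp hg' hr0 hp0).aestronglyMeasurable.mul hmeas
  have hm' : AEStronglyMeasurable F' ν :=
    (ContinuousLinearMap.smulRightL ℝ ℝ ℝ 1).continuous.comp_aestronglyMeasurable hm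
  obtain ⟨hint, key⟩ := hasFDerivAt_integral_of_dominated_loc_of_lip' (μ := ν)
    (F := fun t u => g (r t u) u) (x₀ := (0 : ℝ)) (F' := F') (bound := fun _ => L * D) hs
    (fun t ht => (continuous_uncurry_comp hg (hr t ht.1) (hpos t ht.1)).aestronglyMeasurable)
    (integrable_of_continuous (continuous_uncurry_comp hg hr0 hp0)) hm'
    (Eventually.of_forall fun u t ht => by
      have h1 := hlip t ht.1 u
      have h2 := abs_le.1 (h1.trans ht.2.le)
      have h3 := ha u
      have h4 := (le_abs_self _).trans (hb u)
      have h5 := hL (r 0 u) ⟨by linarith, by linarith⟩ (r t u) ⟨by linarith, by linarith⟩ u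
      rw [sub_zero, Real.norm_eq_abs, Real.norm_eq_abs, mul_assoc]
      exact h5.trans (mul_le_mul_of_nonneg_left h1 hL0))
    (integrable_const _)
    (hr'.mono fun u hu => by
      have h0 : HasDerivAt (fun s => g s u) (g' (r 0 u) u) ((fun t => r t u) 0) :=
        hd _ (hp0 u) u
      have h1 := HasDerivAt.comp (0 : ℝ) h0 hu
      exact h1.hasFDerivAt)
  have hint' : Integrable (fun u => g' (r 0 u) u * r' u) ν := by
    rw [← integrable_norm_iff hm'] at hint
    exact (integrable_norm_iff hm).1 (by simpa [hF'] using! hint)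
  rw [hasDerivAt_iff_hasFDerivAt]
  simpa only [hF', ContinuousLinearMap.integral_comp_comm _ hint'] using! key

end Composition

/-- The function `φ(t) = ∫_0^t ψ(s)/s ds` as a real-valued function. -/
def orliczIntegral (ψ : ℝ → ℝ) (t : ℝ) : ℝ := ∫ s in (0 : ℝ)..t, ψ s / s

/-- The regularity, sign and finiteness assumptions on the pair `(G, ψ)`; the two conditions of
infinite growth are kept apart. -/
structure IsAdmissible (G : ℝ → Sphere n → ℝ) (ψ : ℝ → ℝ) : Prop where
  cont : ContinuousOn (Function.uncurry G) (Ioi 0 ×ˢ univ)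
  pos : ∀ t : ℝ, 0 < t → ∀ u, 0 < G t u
  hasDerivAt : ∀ t : ℝ, 0 < t → ∀ u, HasDerivAt (fun s => G s u) (partialT G t u) t
  contT : ContinuousOn (Function.uncurry (partialT G)) (Ioi 0 ×ˢ univ)
  negT : ∀ t : ℝ, 0 < t → ∀ u, partialT G t u < 0
  cont_psi : ContinuousOn ψ (Ioi 0)
  psi_pos : ∀ t : ℝ, 0 < t → 0 < ψ t
  phi_lt_top : ∀ t : ℝ, 0 < t → orliczPhi ψ t < ⊤

namespace IsAdmissible

variable {G : ℝ → Sphere n → ℝ} {ψ : ℝ → ℝ}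

lemma continuousOn_psi_div (A : IsAdmissible G ψ) : ContinuousOn (fun s => ψ s / s) (Ioi 0) :=
  A.cont_psi.div continuousOn_id fun _ hs => ne_of_gt hs

lemma integrableOn_psi_div (A : IsAdmissible G ψ) {t : ℝ} (ht : 0 < t) :
    IntegrableOn (fun s => ψ s / s) (Ioc 0 t) := by
  refine ⟨(A.continuousOn_psi_div.mono fun s hs => hs.1).aestronglyMeasurable measurableSet_Ioc, ?_⟩
  rw [hasFiniteIntegral_iff_ofReal]
  · exact A.phi_lt_top t ht
  · filter_upwards [ae_restrict_mem measurableSet_Ioc] with s hs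
    exact (div_pos (A.psi_pos s hs.1) hs.1).le

lemma hasDerivAt_orliczIntegral (A : IsAdmissible G ψ) {t : ℝ} (ht : 0 < t) :
    HasDerivAt (orliczIntegral ψ) (ψ t / t) t :=
  intervalIntegral.integral_hasDerivAt_right
    ((intervalIntegrable_iff_integrableOn_Ioc_of_le ht.le).2 (A.integrableOn_psi_div ht))
    (A.continuousOn_psi_div.stronglyMeasurableAtFilter isOpen_Ioi t ht)
    (A.continuousOn_psi_div.continuousAt (Ioi_mem_nhds ht))

lemma orliczIntegral_nonneg (A : IsAdmissible G ψ) {t : ℝ} (ht : 0 < t) :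
    0 ≤ orliczIntegral ψ t := by
  rw [orliczIntegral, intervalIntegral.integral_of_le ht.le]
  exact setIntegral_nonneg measurableSet_Ioc fun s hs => (div_pos (A.psi_pos s hs.1) hs.1).le

lemma orliczIntegral_mono (A : IsAdmissible G ψ) : MonotoneOn (orliczIntegral ψ) (Ioi 0) := by
  refine monotoneOn_of_deriv_nonneg (convex_Ioi 0)
    (fun t ht => (A.hasDerivAt_orliczIntegral ht).continuousAt.continuousWithinAt)
    (fun t ht => ?_) (fun t ht => ?_)
  all_goals rw [interior_Ioi] at ht
  · exact (A.hasDerivAt_orliczIntegral ht).differentiableAt.differentiableWithinAt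
  · rw [(A.hasDerivAt_orliczIntegral ht).deriv]
    exact (div_pos (A.psi_pos t ht) ht).le

lemma exists_lt_orliczIntegral (A : IsAdmissible G ψ)
    (hinf : ∫⁻ s in Ioi (1 : ℝ), ENNReal.ofReal (ψ s / s) = ⊤) (M : ℝ) :
    ∃ t, 0 < t ∧ M < orliczIntegral ψ t := by
  by_contra! hcon
  have hint : ∀ b : ℝ, IntegrableOn (fun s => ψ s / s) (Ioc 1 b) := fun b =>
    (A.integrableOn_psi_div (t := max b 1) (by positivity)).mono_set fun s hs =>
      ⟨zero_lt_one.trans hs.1, hs.2.trans (le_max_left _ _)⟩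
  have h1 : IntegrableOn (fun s => ψ s / s) (Ioi 1) := by
    refine integrableOn_Ioi_of_intervalIntegral_norm_bounded (l := atTop) (b := id) M 1
      (fun b => hint b) tendsto_id ?_
    filter_upwards [eventually_ge_atTop (1 : ℝ)] with b hb
    refine le_trans ?_ (hcon b (zero_lt_one.trans_le hb))
    rw [orliczIntegral, id, intervalIntegral.integral_of_le hb,
      intervalIntegral.integral_of_le (zero_le_one.trans hb)]
    have h2 : ∫ s in Ioc 1 b, ‖ψ s / s‖ = ∫ s in Ioc 1 b, ψ s / s :=
      setIntegral_congr_fun measurableSet_Ioc fun s hs => Real.norm_of_nonneg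
        (div_pos (A.psi_pos s (zero_lt_one.trans hs.1)) (zero_lt_one.trans hs.1)).le
    rw [h2]
    refine setIntegral_mono_set (A.integrableOn_psi_div (zero_lt_one.trans_le hb)) ?_
      (LE.le.eventuallyLE fun s hs => ⟨zero_lt_one.trans hs.1, hs.2⟩)
    filter_upwards [ae_restrict_mem measurableSet_Ioc] with s hs
    exact (div_pos (A.psi_pos s hs.1) hs.1).le
  have h3 := h1.2
  rw [hasFiniteIntegral_iff_ofReal, hinf] at h3
  · exact lt_irrefl _ h3
  · filter_upwards [ae_restrict_mem measurableSet_Ioi] with s hs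
    exact (div_pos (A.psi_pos s (zero_lt_one.trans hs)) (zero_lt_one.trans hs)).le

lemma antitone (A : IsAdmissible G ψ) (u : Sphere n) : AntitoneOn (fun t => G t u) (Ioi 0) := by
  refine antitoneOn_of_deriv_nonpos (convex_Ioi 0)
    (fun t ht => (A.hasDerivAt t ht u).continuousAt.continuousWithinAt)
    (fun t ht => ?_) (fun t ht => ?_)
  all_goals rw [interior_Ioi] at ht
  · exact (A.hasDerivAt t ht u).differentiableAt.differentiableWithinAt
  · rw [(A.hasDerivAt t ht u).deriv]
    exact (A.negT t ht u).le

lemma continuousOn_uncurry_orliczIntegral (A : IsAdmissible G ψ) :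
    ContinuousOn (Function.uncurry fun (t : ℝ) (_ : Sphere n) => orliczIntegral ψ t)
      (Ioi 0 ×ˢ univ) := by
  have h : ContinuousOn (orliczIntegral ψ) (Ioi 0) := fun t ht =>
    (A.hasDerivAt_orliczIntegral ht).continuousAt.continuousWithinAt
  exact h.comp continuousOn_fst fun _ hp => hp.1

lemma continuousOn_uncurry_psi_div (A : IsAdmissible G ψ) :
    ContinuousOn (Function.uncurry fun (t : ℝ) (_ : Sphere n) => ψ t / t) (Ioi 0 ×ˢ univ) :=
  A.continuousOn_psi_div.comp continuousOn_fst fun _ hp => hp.1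

end IsAdmissible

/-! ### Existence of a minimizer of the energy -/

/-- The functional `h ↦ ∫ φ(h) dμ + ∫ G(ρ(u), u) du`, with `ρ` the radial function of the Wulff
shape of `h`. -/
def energy (G : ℝ → Sphere n → ℝ) (ψ : ℝ → ℝ) (μ : Measure (Sphere n)) (h : Sphere n → ℝ) : ℝ :=
  ∫ v, orliczIntegral ψ (h v) ∂μ + ∫ u, G (wulffRadius h u) u ∂surfaceMeasure n

/-- By compactness of the sphere, the caps `{v : δ ≤ ⟨v, w⟩}` carry a uniform amount of mass of a
measure not concentrated on a closed hemisphere. -/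
lemma NotConcentratedOnHemisphere.exists_uniform_cap {μ : Measure (Sphere n)} [IsFiniteMeasure μ]
    (hμ : NotConcentratedOnHemisphere μ) :
    ∃ δ, 0 < δ ∧ ∃ m, 0 < m ∧ ∀ w : Sphere n, m ≤ μ.real (cap δ w) := by
  have hcont : Continuous fun w : Sphere n =>
      ∫ u : Sphere n, max (inner ℝ (u : Space n) (w : Space n)) 0 ∂μ := by
    refine continuous_of_dominated (bound := fun _ => 1) (fun w => ?_) (fun w => ?_)
      (integrable_const _) (Eventually.of_forall fun u => by fun_prop)
    · exact (by fun_prop : Continuous fun u : Sphere n =>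
        max (inner ℝ (u : Space n) (w : Space n)) 0).aestronglyMeasurable
    · refine Eventually.of_forall fun u => ?_
      rw [Real.norm_of_nonneg (le_max_right _ _)]
      have h1 := real_inner_le_norm (u : Space n) (w : Space n)
      rw [norm_sphere, norm_sphere, one_mul] at h1
      exact max_le h1 zero_le_one
  obtain ⟨c, hc0, hc⟩ := exists_pos_le_of_continuous hcont hμ
  set M := μ.real univ with hM
  have hM0 : 0 ≤ M := measureReal_nonneg
  -- The part of the integral where `⟨u, w⟩ ≤ δ` is at most `δ M ≤ c / 2`.
  have hδ : 0 < c / (2 * (M + 1)) := by positivity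
  refine ⟨c / (2 * (M + 1)), hδ, c / 2, by positivity, fun w => ?_⟩
  set δ := c / (2 * (M + 1)) with hδdef
  have hmeas : MeasurableSet (cap δ w) :=
    (isClosed_le continuous_const (by fun_prop)).measurableSet
  have h1 : ∫ u : Sphere n, max (inner ℝ (u : Space n) (w : Space n)) 0 ∂μ ≤
      ∫ u, (δ + (cap δ w).indicator (fun _ => (1 : ℝ)) u) ∂μ := by
    refine integral_mono (integrable_of_continuous (by fun_prop))
      ((integrable_const _).add ((integrable_const _).indicator hmeas)) fun u => ?_
    have h1 := real_inner_le_norm (u : Space n) (w : Space n)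
    rw [norm_sphere, norm_sphere, one_mul] at h1
    by_cases hu : u ∈ cap δ w
    · simp only [indicator_of_mem hu]
      exact max_le (by linarith) (by linarith)
    · simp only [indicator_of_notMem hu, add_zero]
      exact max_le (not_le.1 hu).le hδ.le
  rw [integral_add (integrable_const _) ((integrable_const _).indicator hmeas), integral_const,
    integral_indicator_const _ hmeas, smul_eq_mul, smul_eq_mul, mul_one, ← hM] at h1
  have h2 : M * δ ≤ c / 2 := by
    rw [hδdef, mul_div_assoc', div_le_div_iff₀ (by positivity) two_pos]
    nlinarith
  linarith [hc w]

lemma abs_wulffRadius_sub_le {h₁ h₂ : Sphere n → ℝ} (hc₁ : Continuous h₁) (hc₂ : Continuous h₂)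
    {c R : ℝ} (hc0 : 0 < c) (h₁b : ∀ v, h₁ v ∈ Icc c R) (h₂b : ∀ v, h₂ v ∈ Icc c R) {d : ℝ}
    (hd : ∀ v, |h₁ v - h₂ v| ≤ d) (u : Sphere n) :
    |wulffRadius h₁ u - wulffRadius h₂ u| ≤ R / c * d := by
  have key : ∀ f g : Sphere n → ℝ, Continuous f → Continuous g → (∀ v, f v ∈ Icc c R) →
      (∀ v, g v ∈ Icc c R) → (∀ v, |f v - g v| ≤ d) →
      wulffRadius f u - wulffRadius g u ≤ R / c * d := by
    intro f g hf hg hfb hgb hfg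
    have hd0 : 0 ≤ d := (abs_nonneg _).trans (hfg u)
    have hfp : ∀ v, 0 < f v := fun v => hc0.trans_le (hfb v).1
    have hgp : ∀ v, 0 < g v := fun v => hc0.trans_le (hgb v).1
    have h1 : (1 + d / c)⁻¹ * wulffRadius f u ≤ wulffRadius g u := by
      refine wulffRadius_mul_le hf hfp hg hgp (by positivity) (fun v => ?_) u
      rw [inv_mul_le_iff₀ (by positivity)]
      have h2 := (abs_le.1 (hfg v)).2
      have h3 : d ≤ d / c * g v := by
        rw [div_mul_eq_mul_div, le_div_iff₀ hc0]
        exact mul_le_mul_of_nonneg_left (hgb v).1 hd0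
      linarith
    rw [inv_mul_le_iff₀ (by positivity)] at h1
    have h4 : d / c * wulffRadius g u ≤ d / c * R :=
      mul_le_mul_of_nonneg_left ((wulffRadius_le hg hgp u).trans (hgb u).2) (by positivity)
    have h5 : d / c * R = R / c * d := by ring
    linarith
  rw [abs_le]
  have h1 := key h₁ h₂ hc₁ hc₂ h₁b h₂b hd
  have h2 := key h₂ h₁ hc₂ hc₁ h₂b h₁b fun v => by rw [abs_sub_comm]; exact hd v
  constructor <;> linarith

lemma isCompact_lipschitz_functions (c R : ℝ) :
    IsCompact {f : BoundedContinuousFunction (Sphere n) ℝ |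
      (∀ v, f v ∈ Icc c R) ∧ ∀ v w, |f v - f w| ≤ R * dist v w} := by
  refine BoundedContinuousFunction.arzela_ascoli₂ (Icc c R) isCompact_Icc _ ?_
    (fun f v hf => hf.1 v) ?_
  · have hev : ∀ v : Sphere n, Continuous fun f : BoundedContinuousFunction (Sphere n) ℝ => f v :=
      fun v => by fun_prop
    have : {f : BoundedContinuousFunction (Sphere n) ℝ |
        (∀ v, f v ∈ Icc c R) ∧ ∀ v w, |f v - f w| ≤ R * dist v w} =
        (⋂ v, {f | f v ∈ Icc c R}) ∩ ⋂ v, ⋂ w, {f | |f v - f w| ≤ R * dist v w} := by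
      ext f; simp
    rw [this]
    refine (isClosed_iInter fun v => isClosed_Icc.preimage (hev v)).inter
      (isClosed_iInter fun v => isClosed_iInter fun w => ?_)
    exact isClosed_le ((hev v).sub (hev w)).abs continuous_const
  · refine Metric.equicontinuous_of_continuity_modulus (fun x => R * x) ?_ _ ?_
    · exact (show Continuous fun x : ℝ => R * x by fun_prop).tendsto' 0 0 (by simp)
    · intro v w f
      exact f.2.2 v w

namespace IsAdmissible

variable {G : ℝ → Sphere n → ℝ} {ψ : ℝ → ℝ} {μ : Measure (Sphere n)} [IsFiniteMeasure μ]

lemma integrable_orliczIntegral (A : IsAdmissible G ψ) {h : Sphere n → ℝ} (hc : Continuous h)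
    (hp : ∀ v, 0 < h v) : Integrable (fun v => orliczIntegral ψ (h v)) μ :=
  integrable_of_continuous (continuous_uncurry_comp A.continuousOn_uncurry_orliczIntegral hc hp)

lemma integrable_G (A : IsAdmissible G ψ) {h : Sphere n → ℝ} (hc : Continuous h)
    (hp : ∀ v, 0 < h v) : Integrable (fun u => G (wulffRadius h u) u) (surfaceMeasure n) :=
  integrable_of_continuous
    (continuous_uncurry_comp A.cont (continuous_wulffRadius hc hp) (wulffRadius_pos hc hp))

/-- Bodies of bounded energy are uniformly bounded, as `φ` is unbounded. -/
lemma exists_wulffRadius_le (A : IsAdmissible G ψ)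
    (hinf : ∫⁻ s in Ioi (1 : ℝ), ENNReal.ofReal (ψ s / s) = ⊤)
    (hμ : NotConcentratedOnHemisphere μ) (M : ℝ) :
    ∃ R, 0 < R ∧ ∀ h : Sphere n → ℝ, Continuous h → (∀ v, 0 < h v) → energy G ψ μ h ≤ M →
      ∀ u, wulffRadius h u ≤ R := by
  obtain ⟨δ, hδ, m, hm, hcap⟩ := hμ.exists_uniform_cap
  obtain ⟨T, hT0, hT⟩ := A.exists_lt_orliczIntegral hinf (M / m)
  refine ⟨T / δ, by positivity, fun h hc hp hM u => ?_⟩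
  by_contra! hu
  rw [div_lt_iff₀ hδ] at hu
  have hmeas : MeasurableSet (cap δ u) :=
    (isClosed_le continuous_const (by fun_prop)).measurableSet
  have h1 : ∫ v, (cap δ u).indicator (fun _ => orliczIntegral ψ T) v ∂μ ≤
      ∫ v, orliczIntegral ψ (h v) ∂μ := by
    refine integral_mono ((integrable_const _).indicator hmeas)
      (A.integrable_orliczIntegral hc hp) fun v => ?_
    by_cases hv : v ∈ cap δ u
    · simp only [indicator_of_mem hv]
      refine A.orliczIntegral_mono hT0 (hp v) ?_
      have h2 := mul_le_mul_of_nonneg_left (show δ ≤ inner ℝ (v : Space n) (u : Space n) from hv)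
        (wulffRadius_pos hc hp u).le
      linarith [wulffRadius_mul_inner_le hc hp u v]
    · simp only [indicator_of_notMem hv]
      exact A.orliczIntegral_nonneg (hp v)
  rw [integral_indicator_const _ hmeas, smul_eq_mul] at h1
  have h3 : 0 ≤ ∫ u, G (wulffRadius h u) u ∂surfaceMeasure n :=
    integral_nonneg fun u => (A.pos _ (wulffRadius_pos hc hp u) u).le
  rw [div_lt_iff₀ hm] at hT
  have h4 := mul_le_mul_of_nonneg_right (hcap u) (A.orliczIntegral_nonneg hT0)
  rw [energy] at hM
  linarith

omit [IsFiniteMeasure μ] in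
/-- If `h v` is small, then the Wulff shape of `h` is thin in the directions of the cap around `v`,
on which the integral of `G` is then large. -/
lemma exists_pos_le_of_energy_le (A : IsAdmissible G ψ) {ε₀ : ℝ} (hε₀ : 0 < ε₀)
    (hblowup : ∀ v : Sphere n,
      Tendsto (fun t : ℝ => ∫ u in cap ε₀ v, G t u ∂(surfaceMeasure n)) (𝓝[>] 0) atTop)
    (M : ℝ) (v : Sphere n) :
    ∃ c, 0 < c ∧ ∀ h : Sphere n → ℝ, Continuous h → (∀ v, 0 < h v) → energy G ψ μ h ≤ M →
      c ≤ h v := by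
  obtain ⟨t, hMt, ht0⟩ :=
    (((hblowup v).eventually_gt_atTop M).and self_mem_nhdsWithin).exists
  have ht0 : 0 < t := ht0
  refine ⟨ε₀ * t, by positivity, fun h hc hp hM => ?_⟩
  by_contra! hv
  have hmeas : MeasurableSet (cap ε₀ v) :=
    (isClosed_le continuous_const (by fun_prop)).measurableSet
  have h1 : ∫ u in cap ε₀ v, G t u ∂surfaceMeasure n ≤
      ∫ u in cap ε₀ v, G (wulffRadius h u) u ∂surfaceMeasure n := by
    refine setIntegral_mono_on (integrable_of_continuous
      (continuous_uncurry_comp A.cont continuous_const fun _ => ht0)).integrableOn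
      (A.integrable_G hc hp).integrableOn hmeas fun u hu => ?_
    refine A.antitone u (wulffRadius_pos hc hp u) ht0 ?_
    have hu' : ε₀ ≤ inner ℝ (v : Space n) (u : Space n) := by rw [real_inner_comm]; exact hu
    have h2 := mul_le_mul_of_nonneg_left hu' (wulffRadius_pos hc hp u).le
    have h3 := wulffRadius_mul_inner_le hc hp u v
    exact le_of_mul_le_mul_left (by linarith) hε₀
  have h2 : ∫ u in cap ε₀ v, G (wulffRadius h u) u ∂surfaceMeasure n ≤
      ∫ u, G (wulffRadius h u) u ∂surfaceMeasure n :=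
    setIntegral_le_integral (A.integrable_G hc hp)
      (Eventually.of_forall fun u => (A.pos _ (wulffRadius_pos hc hp u) u).le)
  have h3 : 0 ≤ ∫ v, orliczIntegral ψ (h v) ∂μ :=
    integral_nonneg fun v => A.orliczIntegral_nonneg (hp v)
  rw [energy] at hM
  linarith

omit [IsFiniteMeasure μ] in
/-- The previous bound is uniform in `v` among functions with a common Lipschitz constant, by
compactness of the sphere. -/
lemma exists_uniform_pos_le_of_energy_le (A : IsAdmissible G ψ) {ε₀ : ℝ} (hε₀ : 0 < ε₀)
    (hblowup : ∀ v : Sphere n,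
      Tendsto (fun t : ℝ => ∫ u in cap ε₀ v, G t u ∂(surfaceMeasure n)) (𝓝[>] 0) atTop)
    (M : ℝ) {R : ℝ} (hR : 0 < R) :
    ∃ c, 0 < c ∧ ∀ h : Sphere n → ℝ, Continuous h → (∀ v, 0 < h v) →
      (∀ v w, |h v - h w| ≤ R * dist v w) → energy G ψ μ h ≤ M → ∀ v, c ≤ h v := by
  suffices hsuff : ∃ c, 0 < c ∧ ∀ h : Sphere n → ℝ, Continuous h → (∀ v, 0 < h v) →
      (∀ v w, |h v - h w| ≤ R * dist v w) → energy G ψ μ h ≤ M →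
      ∀ v ∈ (univ : Set (Sphere n)), c ≤ h v by
    simpa using hsuff
  refine isCompact_univ.induction_on (p := fun s : Set (Sphere n) => ∃ c, 0 < c ∧
    ∀ h : Sphere n → ℝ, Continuous h → (∀ v, 0 < h v) → (∀ v w, |h v - h w| ≤ R * dist v w) →
      energy G ψ μ h ≤ M → ∀ v ∈ s, c ≤ h v) ?_ ?_ ?_ ?_
  · exact ⟨1, one_pos, by simp⟩
  · rintro s t hst ⟨c, hc0, hc⟩
    exact ⟨c, hc0, fun h h1 h2 h3 h4 v hv => hc h h1 h2 h3 h4 v (hst hv)⟩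
  · rintro s t ⟨c, hc0, hc⟩ ⟨d, hd0, hd⟩
    refine ⟨min c d, lt_min hc0 hd0, fun h h1 h2 h3 h4 v hv => ?_⟩
    rcases hv with hv | hv
    · exact (min_le_left _ _).trans (hc h h1 h2 h3 h4 v hv)
    · exact (min_le_right _ _).trans (hd h h1 h2 h3 h4 v hv)
  · intro v _
    obtain ⟨c, hc0, hc⟩ := A.exists_pos_le_of_energy_le (μ := μ) hε₀ hblowup M v
    refine ⟨Metric.ball v (c / (2 * R)),
      mem_nhdsWithin_of_mem_nhds (Metric.ball_mem_nhds v (by positivity)), c / 2, by positivity,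
      fun h h1 h2 h3 h4 w hw => ?_⟩
    have h5 := abs_le.1 (h3 w v)
    have h6 := hc h h1 h2 h4
    have h7 := Metric.mem_ball.1 hw
    rw [lt_div_iff₀ (by positivity)] at h7
    linarith

/-- Passing from `h` to the support function of its Wulff shape does not increase the energy: the
Wulff shape stays the same, and the function gets smaller. -/
lemma energy_supportFunction_le (A : IsAdmissible G ψ) {h : Sphere n → ℝ} (hc : Continuous h)
    (hp : ∀ v, 0 < h v) :
    energy G ψ μ (fun v => supportFunction (wulffShape h) (v : Space n)) ≤ energy G ψ μ h := by
  have hK := isOriginBody_wulffShape hc hp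
  have h1 : wulffRadius (fun v : Sphere n => supportFunction (wulffShape h) (v : Space n)) =
      wulffRadius h := by
    ext u; rw [wulffRadius, wulffShape_supportFunction hc hp, wulffRadius]
  rw [energy, energy, h1]
  refine add_le_add_left (integral_mono (A.integrable_orliczIntegral
    (hK.continuous_supportFunction.comp continuous_subtype_val) hK.supportFunction_pos)
    (A.integrable_orliczIntegral hc hp) fun v => ?_) _
  exact A.orliczIntegral_mono (hK.supportFunction_pos v) (hp v) (supportFunction_wulffShape_le hc hp v)

lemma continuousOn_energy (A : IsAdmissible G ψ) {c R : ℝ} (hc0 : 0 < c) :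
    ContinuousOn (fun f : BoundedContinuousFunction (Sphere n) ℝ => energy G ψ μ f)
      {f | ∀ v, f v ∈ Icc c R} := by
  obtain ⟨L₁, hL₁, h₁⟩ := exists_lipschitz_integral μ A.continuousOn_uncurry_orliczIntegral
    (fun t ht _ => A.hasDerivAt_orliczIntegral ht) A.continuousOn_uncurry_psi_div (b := R) hc0
  obtain ⟨L₂, hL₂, h₂⟩ := exists_lipschitz_integral (surfaceMeasure n) A.cont A.hasDerivAt A.contT
    (b := R) hc0
  have hlip : LipschitzOnWith (L₁ + L₂ * (R / c)).toNNReal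
      (fun f : BoundedContinuousFunction (Sphere n) ℝ => energy G ψ μ f)
      {f | ∀ v, f v ∈ Icc c R} := by
    refine LipschitzOnWith.of_dist_le_mul fun f hf g hg => ?_
    have hd : ∀ v, |f v - g v| ≤ dist f g := fun v => f.dist_coe_le_dist v
    have hr : ∀ f : BoundedContinuousFunction (Sphere n) ℝ, (∀ v, f v ∈ Icc c R) →
        ∀ u, wulffRadius f u ∈ Icc c R := fun f hf u =>
      have hp : ∀ v, 0 < f v := fun v => hc0.trans_le (hf v).1
      ⟨le_wulffRadius f.continuous hp hc0.le (fun v => (hf v).1) u,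
        (wulffRadius_le f.continuous hp u).trans (hf u).2⟩
    have hcr : ∀ f : BoundedContinuousFunction (Sphere n) ℝ, (∀ v, f v ∈ Icc c R) →
        Continuous (wulffRadius f) := fun f hf =>
      continuous_wulffRadius f.continuous fun v => hc0.trans_le (hf v).1
    have e₁ := h₁ f g f.continuous g.continuous hf hg _ hd
    have e₂ := h₂ _ _ (hcr f hf) (hcr g hg) (hr f hf) (hr g hg) _
      (abs_wulffRadius_sub_le f.continuous g.continuous hc0 hf hg hd)
    rw [Real.dist_eq, energy, energy]
    have h3 : (L₁ + L₂ * (R / c)) * dist f g ≤ (L₁ + L₂ * (R / c)).toNNReal * dist f g :=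
      mul_le_mul_of_nonneg_right (Real.le_coe_toNNReal _) dist_nonneg
    refine le_trans ?_ h3
    rw [add_sub_add_comm]
    refine (abs_add_le _ _).trans ((add_le_add e₁ e₂).trans (le_of_eq (by ring)))
  exact hlip.continuousOn

/-- The energy attains its minimum over the positive continuous functions. -/
theorem exists_isMin_energy (A : IsAdmissible G ψ) {ε₀ : ℝ} (hε₀ : 0 < ε₀)
    (hblowup : ∀ v : Sphere n,
      Tendsto (fun t : ℝ => ∫ u in cap ε₀ v, G t u ∂(surfaceMeasure n)) (𝓝[>] 0) atTop)
    (hinf : ∫⁻ s in Ioi (1 : ℝ), ENNReal.ofReal (ψ s / s) = ⊤)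
    (hμ : NotConcentratedOnHemisphere μ) :
    ∃ h : Sphere n → ℝ, Continuous h ∧ (∀ v, 0 < h v) ∧
      ∀ h' : Sphere n → ℝ, Continuous h' → (∀ v, 0 < h' v) → energy G ψ μ h ≤ energy G ψ μ h' := by
  set M := energy G ψ μ fun _ => 1 with hM
  obtain ⟨R, hR0, hR⟩ := A.exists_wulffRadius_le hinf hμ M
  obtain ⟨c, hc0, hc⟩ := A.exists_uniform_pos_le_of_energy_le (μ := μ) hε₀ hblowup M hR0
  -- Support functions of bodies of energy at most `M` lie in a fixed compact set.
  have hred : ∀ h : Sphere n → ℝ, Continuous h → (∀ v, 0 < h v) → energy G ψ μ h ≤ M →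
      ∃ f : BoundedContinuousFunction (Sphere n) ℝ,
        ((∀ v, f v ∈ Icc c R) ∧ ∀ v w, |f v - f w| ≤ R * dist v w) ∧
        energy G ψ μ f ≤ energy G ψ μ h := by
    intro h hcont hp hle
    have hK := isOriginBody_wulffShape hcont hp
    have hn : ∀ x ∈ wulffShape h, ‖x‖ ≤ R := by
      intro x hx
      rcases eq_or_ne x 0 with rfl | h0
      · simpa using hR0.le
      · have hpos := norm_pos_iff.2 h0
        set u : Sphere n := ⟨‖x‖⁻¹ • x, by simp [norm_smul, hpos.ne']⟩ with hu
        refine le_trans ((hK.smul_mem_iff u (norm_nonneg x)).1 ?_) (hR h hcont hp hle u)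
        rwa [hu, smul_inv_smul₀ hpos.ne']
    have hcs : Continuous fun v : Sphere n => supportFunction (wulffShape h) (v : Space n) :=
      hK.continuous_supportFunction.comp continuous_subtype_val
    have hE := A.energy_supportFunction_le (μ := μ) hcont hp
    have hlip : ∀ v w : Sphere n, |supportFunction (wulffShape h) (v : Space n) -
        supportFunction (wulffShape h) (w : Space n)| ≤ R * dist v w := by
      intro v w
      have h1 := supportFunction_le_add hK.compact hK.nonempty hn (v : Space n) w
      have h2 := supportFunction_le_add hK.compact hK.nonempty hn (w : Space n) v
      rw [norm_sub_rev] at h2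
      rw [Subtype.dist_eq, dist_eq_norm, abs_le]
      constructor <;> linarith
    refine ⟨BoundedContinuousFunction.mkOfCompact ⟨_, hcs⟩, ⟨fun v => ⟨?_, ?_⟩, hlip⟩, hE⟩
    · exact hc _ hcs hK.supportFunction_pos hlip (hE.trans hle) v
    · refine supportFunction_le hK.nonempty fun x hx => ?_
      have h1 := real_inner_le_norm (v : Space n) x
      rw [norm_sphere, one_mul] at h1
      exact h1.trans (hn x hx)
  obtain ⟨f₁, hf₁, hE₁⟩ := hred (fun _ => 1) continuous_const (fun _ => one_pos) le_rfl
  obtain ⟨f, hf, hmin⟩ := (isCompact_lipschitz_functions c R).exists_isMinOn ⟨f₁, hf₁⟩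
    ((A.continuousOn_energy (μ := μ) hc0).mono fun f hf => hf.1)
  refine ⟨f, f.continuous, fun v => hc0.trans_le (hf.1 v).1, fun h' hc' hp' => ?_⟩
  -- Functions of energy above `M` are beaten by the constant function `1`.
  rcases le_or_gt (energy G ψ μ h') M with hle | hgt
  · obtain ⟨f₂, hf₂, hE₂⟩ := hred h' hc' hp' hle
    exact (hmin hf₂).trans hE₂
  · exact (hmin hf₁).trans (hE₁.trans hgt.le)

end IsAdmissible

/-! ### The Euler–Lagrange equation and the Minkowski problem -/

namespace IsAdmissible

variable {G : ℝ → Sphere n → ℝ} {ψ : ℝ → ℝ} {μ : Measure (Sphere n)} [IsFiniteMeasure μ]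

/-- The Euler–Lagrange equation of the energy, tested against the perturbations `h (1 + t k)`. -/
lemma euler_lagrange (A : IsAdmissible G ψ) {h : Sphere n → ℝ} (hc : Continuous h)
    (hp : ∀ v, 0 < h v)
    (hmin : ∀ h' : Sphere n → ℝ, Continuous h' → (∀ v, 0 < h' v) →
      energy G ψ μ h ≤ energy G ψ μ h') {k : Sphere n → ℝ} (hk : Continuous k) :
    ∫ v, ψ (h v) * k v ∂μ + ∫ u, wulffRadius h u * partialT G (wulffRadius h u) u *
      k (radialGaussMap (wulffShape h) u) ∂surfaceMeasure n = 0 := by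
  have hK := isOriginBody_wulffShape hc hp
  obtain ⟨B, hB0, hB⟩ := exists_pos_norm_le_of_continuous hk
  obtain ⟨R, hR0, hR⟩ := exists_pos_norm_le_of_continuous hc
  have hδ : 0 < B⁻¹ := inv_pos.2 hB0
  have hδ' : ∀ t : ℝ, |t| < B⁻¹ → |t| * B < 1 := fun t ht => by
    rwa [← one_div, lt_div_iff₀ hB0] at ht
  have d₁ := hasDerivAt_integral_comp μ (r := perturb h k) (D := R * B) (r' := fun v => h v * k v)
    A.continuousOn_uncurry_orliczIntegral
    (fun t ht _ => A.hasDerivAt_orliczIntegral ht) A.continuousOn_uncurry_psi_div hδ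
    (fun t _ => continuous_perturb hc hk t) (fun t ht => perturb_pos hp hB (hδ' t ht))
    (fun t _ u => by
      have h1 : perturb h k t u - perturb h k 0 u = h u * (t * k u) := by
        simp only [perturb]; ring
      rw [h1, abs_mul, mul_assoc, mul_comm B]
      exact mul_le_mul (hR u) (abs_mul_le_of_abs_le (hB u)) (abs_nonneg _) hR0.le)
    (hc.mul hk).aestronglyMeasurable
    (Eventually.of_forall fun v => by
      have h1 : HasDerivAt (fun t : ℝ => 1 + t * k v) (k v) 0 := by
        simpa using ((hasDerivAt_id (0 : ℝ)).mul_const (k v)).const_add 1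
      exact h1.const_mul (h v))
  have d₂ := hasDerivAt_integral_comp (surfaceMeasure n)
    (r := fun t => wulffRadius (perturb h k t)) (D := R * B)
    (r' := fun u => wulffRadius h u * k (radialGaussMap (wulffShape h) u))
    A.cont A.hasDerivAt A.contT hδ
    (fun t ht => continuous_wulffRadius (continuous_perturb hc hk t) (perturb_pos hp hB (hδ' t ht)))
    (fun t ht => wulffRadius_pos (continuous_perturb hc hk t) (perturb_pos hp hB (hδ' t ht)))
    (fun t ht u => by
      rw [perturb_zero]
      refine (abs_wulffRadius_perturb_sub_le hc hp hk hB (hδ' t ht) u).trans ?_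
      have h1 := (wulffRadius_le hc hp u).trans ((le_abs_self _).trans (hR u))
      have h2 : 0 ≤ |t| * B := by positivity
      nlinarith)
    ((continuous_wulffRadius hc hp).aestronglyMeasurable.mul
      (hk.measurable.comp_aemeasurable hK.aemeasurable_radialGaussMap).aestronglyMeasurable)
    (hK.ae_differentiableAt_gauge.mono fun u hu => hasDerivAt_wulffRadius_perturb hc hp hk hu)
  have hloc : IsLocalMin (fun t => energy G ψ μ (perturb h k t)) 0 := by
    filter_upwards [continuous_abs.continuousAt.eventually_lt continuousAt_const
      (show |(0 : ℝ)| < B⁻¹ by simpa using hδ)] with t ht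
    rw [perturb_zero]
    exact hmin _ (continuous_perturb hc hk t) (perturb_pos hp hB (hδ' t ht))
  have h0 := hloc.hasDerivAt_eq_zero (d₁.add d₂)
  rw [← h0, perturb_zero]
  congr 1
  · refine integral_congr_ae (Eventually.of_forall fun v => ?_)
    have := (hp v).ne'
    simp only
    field_simp
  · refine integral_congr_ae (Eventually.of_forall fun u => ?_)
    simp only
    ring

/-- For a minimizer `h` with Wulff shape `K`, the measure `μ` is the image under the radial Gauss
map of the measure with density `-curvatureDensity`. -/
lemma eq_map_of_isMin (A : IsAdmissible G ψ) {h : Sphere n → ℝ} (hc : Continuous h)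
    (hp : ∀ v, 0 < h v)
    (hmin : ∀ h' : Sphere n → ℝ, Continuous h' → (∀ v, 0 < h' v) →
      energy G ψ μ h ≤ energy G ψ μ h') :
    μ = ((surfaceMeasure n).withDensity fun u =>
      ENNReal.ofReal (-curvatureDensity G ψ (wulffShape h) u)).map
        (radialGaussMap (wulffShape h)) := by
  have hK := isOriginBody_wulffShape hc hp
  set w : Sphere n → ℝ := curvatureDensity G ψ (wulffShape h) with hw
  have hwi : Integrable w (surfaceMeasure n) :=
    hK.integrable_curvatureDensity A.contT A.cont_psi A.psi_pos
  have hwneg : ∀ u, w u < 0 := hK.curvatureDensity_neg A.negT A.psi_pos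
  have : IsFiniteMeasure ((surfaceMeasure n).withDensity fun u => ENNReal.ofReal (-w u)) :=
    isFiniteMeasure_withDensity_ofReal hwi.neg.2
  have hα : AEMeasurable (radialGaussMap (wulffShape h))
      ((surfaceMeasure n).withDensity fun u => ENNReal.ofReal (-w u)) :=
    hK.aemeasurable_radialGaussMap.mono_ac (withDensity_absolutelyContinuous _ _)
  refine ext_of_forall_integral_eq_of_IsFiniteMeasure fun f => ?_
  rw [integral_map hα f.continuous.aestronglyMeasurable,
    integral_withDensity_eq_integral_toReal_smul₀ (f := fun u => ENNReal.ofReal (-w u)) hwi.aemeasurable.neg.ennreal_ofReal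
      (Eventually.of_forall fun u => ENNReal.ofReal_lt_top)]
  have hψh : Continuous fun v => ψ (h v) := A.cont_psi.comp_continuous hc hp
  have hψ0 : ∀ v, ψ (h v) ≠ 0 := fun v => (A.psi_pos _ (hp v)).ne'
  have hEL := A.euler_lagrange hc hp hmin (k := fun v => f v / ψ (h v))
    (f.continuous.div hψh hψ0)
  have h1 : ∫ v, ψ (h v) * (f v / ψ (h v)) ∂μ = ∫ v, f v ∂μ :=
    integral_congr_ae (Eventually.of_forall fun v => mul_div_cancel₀ _ (hψ0 v))
  rw [h1] at hEL
  rw [eq_neg_of_add_eq_zero_left hEL, ← integral_neg]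
  refine integral_congr_ae ?_
  filter_upwards [hK.ae_differentiableAt_gauge] with u hu
  simp only [smul_eq_mul]
  rw [ENNReal.toReal_ofReal (neg_pos.2 (hwneg u)).le, hw, curvatureDensity,
    supportFunction_radialGaussMap_wulffShape hc hp hu]
  simp only [wulffRadius]
  ring

/-- The Wulff shape of a minimizer solves the Minkowski problem with constant `-n`. -/
lemma measureReal_eq_of_isMin (A : IsAdmissible G ψ) (hn : 1 ≤ n) {h : Sphere n → ℝ}
    (hc : Continuous h) (hp : ∀ v, 0 < h v)
    (hmin : ∀ h' : Sphere n → ℝ, Continuous h' → (∀ v, 0 < h' v) →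
      energy G ψ μ h ≤ energy G ψ μ h') {E : Set (Sphere n)} (hE : MeasurableSet E) :
    μ.real E = -(n : ℝ) * dualOrliczCurvature G ψ (wulffShape h) E := by
  have hK := isOriginBody_wulffShape hc hp
  have hwi : Integrable (curvatureDensity G ψ (wulffShape h)) (surfaceMeasure n) :=
    hK.integrable_curvatureDensity A.contT A.cont_psi A.psi_pos
  have hα := hK.aemeasurable_radialGaussMap
  have hnull : NullMeasurableSet (radialGaussMap (wulffShape h) ⁻¹' E) (surfaceMeasure n) :=
    hα.nullMeasurable hE
  rw [hK.dualOrliczCurvature_eq, measureReal_def, A.eq_map_of_isMin hc hp hmin,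
    Measure.map_apply_of_aemeasurable (hα.mono_ac (withDensity_absolutelyContinuous _ _)) hE,
    withDensity_apply₀ _ hnull]
  have hn0 : (n : ℝ) ≠ 0 := by positivity
  rw [← mul_assoc, neg_mul, mul_one_div_cancel hn0, neg_one_mul, ← integral_neg,
    integral_eq_lintegral_of_nonneg_ae (Eventually.of_forall fun u =>
      (neg_pos.2 (hK.curvatureDensity_neg A.negT A.psi_pos u)).le)
      hwi.neg.aestronglyMeasurable.restrict]

end IsAdmissible

end DualOrlicz

end

theorem mainTheorem4 (n : ℕ) (hn : 1 ≤ n)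
    (G : ℝ → DualOrlicz.Sphere n → ℝ)
    (hGcont : ContinuousOn (Function.uncurry G) (Ioi 0 ×ˢ univ))
    (hGpos : ∀ t : ℝ, 0 < t → ∀ u, 0 < G t u)
    (hGdiff : ∀ t : ℝ, 0 < t → ∀ u, DifferentiableAt ℝ (fun s => G s u) t)
    (hGtcont : ContinuousOn (Function.uncurry (DualOrlicz.partialT G)) (Ioi 0 ×ˢ univ))
    (hGtneg : ∀ t : ℝ, 0 < t → ∀ u, DualOrlicz.partialT G t u < 0)
    (ε₀ : ℝ) (hε₀ : 0 < ε₀) (hε₀' : ε₀ < 1)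
    (hblowup : ∀ v : DualOrlicz.Sphere n,
      Tendsto (fun t : ℝ => ∫ u in DualOrlicz.cap ε₀ v, G t u ∂(DualOrlicz.surfaceMeasure n))
        (𝓝[>] 0) atTop)
    (ψ : ℝ → ℝ) (hψcont : ContinuousOn ψ (Ioi 0)) (hψpos : ∀ t : ℝ, 0 < t → 0 < ψ t)
    (hψinf : ∫⁻ s in Ioi (1 : ℝ), ENNReal.ofReal (ψ s / s) = ⊤)
    (hφ : ∀ t : ℝ, 0 < t → DualOrlicz.orliczPhi ψ t < ⊤)
    (μ : Measure (DualOrlicz.Sphere n)) [IsFiniteMeasure μ] :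
    DualOrlicz.NotConcentratedOnHemisphere μ ↔
      ∃ K : ConvexBody (DualOrlicz.Space n), ∃ τ : ℝ,
        (0 : DualOrlicz.Space n) ∈ interior (K : Set (DualOrlicz.Space n)) ∧ τ < 0 ∧
        (∀ E : Set (DualOrlicz.Sphere n), MeasurableSet E →
          μ.real E = τ * DualOrlicz.dualOrliczCurvature G ψ K E) ∧
        τ = μ.real univ / DualOrlicz.dualOrliczCurvature G ψ K univ := by
  have A : DualOrlicz.IsAdmissible G ψ := ⟨hGcont, hGpos,
    fun t ht u => (hGdiff t ht u).hasDerivAt, hGtcont, hGtneg, hψcont, hψpos, hφ⟩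
  constructor
  · intro hμ
    obtain ⟨h, hc, hp, hmin⟩ := A.exists_isMin_energy hε₀ hblowup hψinf hμ
    have hK := DualOrlicz.isOriginBody_wulffShape hc hp
    have hE := fun E hE => A.measureReal_eq_of_isMin hn hc hp hmin (E := E) hE
    have hn0 : (0 : ℝ) < n := by exact_mod_cast hn
    refine ⟨⟨DualOrlicz.wulffShape h, hK.convex, hK.compact, hK.nonempty⟩, -(n : ℝ),
      mem_interior_iff_mem_nhds.2 hK.nhds, neg_lt_zero.2 hn0, hE, ?_⟩
    have hv : Nonempty (DualOrlicz.Sphere n) :=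
      ⟨⟨EuclideanSpace.single ⟨0, hn⟩ 1, by simp⟩⟩
    obtain ⟨v⟩ := hv
    have hμ0 : μ.real univ ≠ 0 := by
      intro h0
      have h1 : μ = 0 := by
        rwa [measureReal_eq_zero_iff, Measure.measure_univ_eq_zero] at h0
      have h2 := hμ v
      rw [h1, integral_zero_measure] at h2
      exact lt_irrefl _ h2
    have h1 := hE univ MeasurableSet.univ
    refine eq_div_of_mul_eq (fun h0 => hμ0 ?_) h1.symm
    rw [h1]
    exact mul_eq_zero_of_right _ h0
  · rintro ⟨K, τ, h0, hτ, hE, -⟩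
    have hK : DualOrlicz.IsOriginBody (K : Set (DualOrlicz.Space n)) :=
      ⟨K.convex, K.isCompact, mem_interior_iff_mem_nhds.1 h0⟩
    exact hK.notConcentrated_of_eq_curvature hn hGtcont hGtneg hψcont hψpos hτ hE
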